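/- Let $n\ge 1$ and $v_1,\dots,v_n>0$. Let $W^n=\{x\in\mathbb Z^n: x_1\le\dots\le x_n\}$, and for $x\in W^n$ let $$S_x(v)=\frac{\det\big(v_i^{x_j+j-1}\big)_{i,j=1}^n}{\det\big(v_i^{j-1}\big)_{i,j=1}^n}$$ be the Schur function (extended by continuity when some of the $v_i$ coincide). Let $\mathbb K_n$ be the set of integer Gelfand–Tsetlin patterns $x=(x^j_i)_{1\le i\le j\le n}$ with $x^{j+1}_i\le x^j_i\le x^{j+1}_{i+1}$, and write $x^j=(x^j_1,\dots,x^j_j)$, $|x^j|=\sum_i x^j_i$, $|x^0|=0$ and $w_v(x)=\prod_{i=1}^n v_i^{|x^i|-|x^{i-1}|}$. For $z\in W^n$ let $M_z$ be the probability measure on $\{x\in\mathbb K_n:x^n=z\}$ given by $M_z(x)=w_v(x)/S_z(v)$. Push–block dynamics is the continuous-time Markov process $(\mathfrak X(t))_{t\ge0}$ on $\mathbb K_n$ in which each particle $\mathfrak X^j_i$ has two exponential clocks with rates $v_j$ (right) and $v_j^{-1}$ (left), all independent. When the right clock of $\mathfrak X^j_i$ rings: if $i\le j-1$ and $\mathfrak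 X^j_i=\mathfrak X^{j-1}_i$, the jump is suppressed; otherwise $\mathfrak X^j_i$ jumps right by one, and if $j<n$ and $\mathfrak X^j_i=\mathfrak X^{j+1}_{i+1}$ before the jump, then $\mathfrak X^{j+1}_{i+1}$ is also pushed right by one, which may push $\mathfrak X^{j+2}_{i+2}$ in the same way, and so on; all other particles stay. When the left clock of $\mathfrak X^j_i$ rings: if $i\ge2$ and $\mathfrak X^j_i=\mathfrak X^{j-1}_{i-1}$, the jump is suppressed; otherwise $\mathfrak X^j_i$ jumps left by one, and if $j<n$ and $\mathfrak X^j_i=\mathfrak X^{j+1}_i$ before the jump, then $\mathfrak X^{j+1}_i$ is also pushed left by one, which may push $\mathfrak X^{j+2}_i$ in the same way, and so on; all other particles stay. **Proposition.** Let $z\in W^n$ and suppose that $\mathfrak X(0)$ has distribution $M_z$. Then the bottom level $(\mathfrak X^n(t))_{t\ge0}$ is a Markov process on $W^n$ with $Q$-matrix given, for $x\in W^n$, by $$Q(x,x\pm e_i)=\frac{S_{x\pm e_i}(v)}{S_x(v)}\,1_{\{x\pm e_i\in W^n\}},\quad i=1,\dots,n,\qquad Q(x,x)=-\sum_{i=1}^n\big(v_i+v_i^{-1}\big),$$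 all other entries being zero, and this $Q$-matrix is conservative (its off-diagonal entries are nonnegative and each row sums to $0$). -/

import Mathlib

open Filter Topology MeasureTheory
open scoped NNReal BigOperators

noncomputable section

/-! ### Continuous-time Markov processes on a countable state space -/

/-- An honest transition function on `S`: stochastic matrices `P t`, `t ≥ 0`, with `P 0 = 1` that
satisfy the Chapman–Kolmogorov equations. -/
structure IsTransitionFunction {S : Type*} (P : ℝ≥0 → S → S → ℝ) : Prop where
  nonneg : ∀ t x y, 0 ≤ P t x y
  hasSum_one : ∀ t x, HasSum (fun y => P t x y) 1
  zero_self : ∀ x, P 0 x x = 1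
  zero_of_ne : ∀ x y, x ≠ y → P 0 x y = 0
  chapman_kolmogorov : ∀ s t x z, HasSum (fun y => P s x y * P t y z) (P (s + t) x z)

open Classical in
/-- `Q` is the `Q`-matrix of the transition function `P`, that is, `Q` is the entrywise (right)
derivative of `P` at time `0`. -/
def HasQMatrix {S : Type*} (P : ℝ≥0 → S → S → ℝ) (Q : S → S → ℝ) : Prop :=
  ∀ x y, Tendsto (fun h : ℝ≥0 => (P h x y - if x = y then 1 else 0) / (h : ℝ))
    (𝓝[>] 0) (𝓝 (Q x y))

/-- A conservative `Q`-matrix: finite entries, nonnegative off the diagonal, with row sums `0`. -/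
def IsConservativeQMatrix {S : Type*} (Q : S → S → ℝ) : Prop :=
  (∀ x y, x ≠ y → 0 ≤ Q x y) ∧ ∀ x, HasSum (fun y => Q x y) 0

/-- The process `X` on `(Ω, μ)`, with values in the (countable, discrete) space `S`, is a
continuous-time Markov process with `Q`-matrix `Q`: it has almost surely right-continuous paths and
it is Markov (with respect to its own filtration) with some transition function `P` whose
`Q`-matrix is `Q`. -/
def IsMarkovProcess {Ω S : Type*} [MeasurableSpace Ω] (μ : Measure Ω) (X : ℝ≥0 → Ω → S)
    (Q : S → S → ℝ) : Prop :=
  (∀ t s, MeasurableSet {ω | X t ω = s}) ∧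
  (∀ᵐ ω ∂μ, ∀ t, ∀ᶠ u in 𝓝[≥] t, X u ω = X t ω) ∧
  ∃ P : ℝ≥0 → S → S → ℝ, IsTransitionFunction P ∧ HasQMatrix P Q ∧
    ∀ (m : ℕ) (t : Fin (m + 1) → ℝ≥0) (x : Fin (m + 1) → S), Monotone t →
      μ.real {ω | ∀ i, X (t i) ω = x i} =
        μ.real {ω | X (t 0) ω = x 0} *
          ∏ i : Fin m, P (t i.succ - t i.castSucc) (x i.castSucc) (x i.succ)

/-! ### The Weyl chamber and Schur functions -/

/-- `W^n`: weakly increasing integer vectors `x_1 ≤ … ≤ x_n`. -/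
def WeylChamber (n : ℕ) : Type := {x : Fin n → ℤ // Monotone x}

/-- The quotient of alternants `det (v_i ^ (x_j + j - 1)) / det (v_i ^ (j - 1))` of Weyl's character
formula (the indices `i, j` start from `0` in the code). It is meaningful for distinct `v_i`. -/
def alternantQuotient {n : ℕ} (x : Fin n → ℤ) (v : Fin n → ℝ) : ℝ :=
  (Matrix.of fun i j : Fin n => v i ^ (x j + ((j : ℕ) : ℤ))).det /
    (Matrix.of fun i j : Fin n => v i ^ (j : ℕ)).det

/-- The Schur function `S_x(v)`: the quotient of alternants, extended by continuity to the `v` that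
have equal coordinates. -/
def schur {n : ℕ} (x : Fin n → ℤ) (v : Fin n → ℝ) : ℝ :=
  limUnder (𝓝[{u | Function.Injective u}] v) (alternantQuotient x)

/-- At a `v` with distinct nonzero coordinates, `S_x(v)` is the quotient of alternants. -/
theorem schur_eq_alternantQuotient {n : ℕ} (x : Fin n → ℤ) (v : Fin n → ℝ) (h0 : ∀ i, v i ≠ 0)
    (hv : Function.Injective v) : schur x v = alternantQuotient x v := by
  have hmem : v ∈ {u : Fin n → ℝ | Function.Injective u} := hv
  have : (𝓝[{u : Fin n → ℝ | Function.Injective u}] v).NeBot :=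
    mem_closure_iff_nhdsWithin_neBot.1 (subset_closure hmem)
  have hc : ContinuousAt (alternantQuotient x) v := by
    unfold alternantQuotient
    refine ContinuousAt.div ?_ ?_ (Matrix.det_vandermonde_ne_zero_iff.2 hv)
    · simp only [Matrix.det_apply]
      refine tendsto_finsetSum _ fun σ _ => Tendsto.const_smul ?_ _
      refine tendsto_finsetProd _ fun i _ => ?_
      exact ((continuous_apply (σ i)).continuousAt).zpow₀ _ (Or.inl (h0 _))
    · refine Continuous.continuousAt ?_
      refine Continuous.matrix_det ?_
      refine continuous_matrix fun i j => ?_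
      exact (continuous_apply i).pow _
  exact (hc.tendsto.mono_left nhdsWithin_le_nhds).limUnder_eq

open Classical in
/-- The matrix indexed by `W^n` with `Q(x, x ± e_i) = S_{x ± e_i}(v) / S_x(v)` whenever
`x ± e_i ∈ W^n`, with `Q(x, x) = - ∑ i, (v_i⁻¹ + v_i)`, and with all other entries zero. -/
def schurQ {n : ℕ} (v : Fin n → ℝ) (x y : WeylChamber n) : ℝ :=
  if y = x then - ∑ i, ((v i)⁻¹ + v i)
  else if ∃ i, y.1 = x.1 + Pi.single i 1 ∨ y.1 = x.1 - Pi.single i 1 then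
    schur y.1 v / schur x.1 v
  else 0

/-! ### Gelfand–Tsetlin patterns -/

/-- Labels of the particles of a triangular array with `n` levels. The label `(j, i)` with
`i ≤ j < n` stands for the particle `x^{j+1}_{i+1}`, the `(i+1)`-st one on the `(j+1)`-st level. -/
abbrev GTIndex (n : ℕ) : Type := {p : Fin n × Fin n // p.2 ≤ p.1}

/-- `q` is the particle `x^{j+1}_i` if `p` is the particle `x^j_i`. -/
def GTIndex.Below {n : ℕ} (p q : GTIndex n) : Prop :=
  (q.1.1 : ℕ) = p.1.1 + 1 ∧ (q.1.2 : ℕ) = p.1.2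

/-- `q` is the particle `x^{j+1}_{i+1}` if `p` is the particle `x^j_i`. -/
def GTIndex.BelowNext {n : ℕ} (p q : GTIndex n) : Prop :=
  (q.1.1 : ℕ) = p.1.1 + 1 ∧ (q.1.2 : ℕ) = p.1.2 + 1

/-- The interlacing conditions `x^{j+1}_i ≤ x^j_i ≤ x^{j+1}_{i+1}`. -/
def IsGTPattern {n : ℕ} (x : GTIndex n → ℤ) : Prop :=
  ∀ p q : GTIndex n, (p.Below q → x q ≤ x p) ∧ (p.BelowNext q → x p ≤ x q)

/-- The set `𝕂_n` of Gelfand–Tsetlin patterns with `n` levels. -/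
def GTPattern (n : ℕ) : Type := {x : GTIndex n → ℤ // IsGTPattern x}

/-- The label of the `(i+1)`-st particle on the bottom level (level `n`). -/
def bottomIndex {n : ℕ} (i : Fin n) : GTIndex n :=
  ⟨(⟨n - 1, by have := i.2; omega⟩, i), by
    have := i.2
    show (i : ℕ) ≤ n - 1
    omega⟩

theorem bottom_monotone {n : ℕ} (x : GTIndex n → ℤ) (hx : IsGTPattern x) :
    Monotone fun i : Fin n => x (bottomIndex i) := by
  cases n with
  | zero => exact fun i => i.elim0
  | succ n =>
    refine Fin.monotone_iff_le_succ.2 fun i => ?_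
    have hi := i.2
    let p : GTIndex (n + 1) := ⟨(⟨n - 1, by omega⟩, ⟨i, by omega⟩), by
      show (i : ℕ) ≤ n - 1
      omega⟩
    have h1 : x (bottomIndex i.castSucc) ≤ x p :=
      (hx p _).1 ⟨by simp [bottomIndex, p]; omega, by simp [bottomIndex, p]⟩
    have h2 : x p ≤ x (bottomIndex i.succ) :=
      (hx p _).2 ⟨by simp [bottomIndex, p]; omega, by simp [bottomIndex, p]⟩
    exact h1.trans h2

/-- The bottom level `x^n ∈ W^n` of a pattern `x ∈ 𝕂_n`. -/
def GTPattern.bottom {n : ℕ} (x : GTPattern n) : WeylChamber n :=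
  ⟨fun i => x.1 (bottomIndex i), bottom_monotone x.1 x.2⟩

/-- `|x^k|`, the sum of the positions on the `k`-th level, `1 ≤ k ≤ n`; it is `0` for `k = 0`. -/
def levelSum {n : ℕ} (x : GTIndex n → ℤ) (k : ℕ) : ℤ :=
  ∑ p : GTIndex n with (p.1.1 : ℕ) + 1 = k, x p

/-- The weight `w_v(x) = ∏ i, v_i ^ (|x^i| - |x^{i-1}|)`. -/
def weight {n : ℕ} (v : Fin n → ℝ) (x : GTPattern n) : ℝ :=
  ∏ i : Fin n, v i ^ (levelSum x.1 (i + 1) - levelSum x.1 i)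

open Classical in
/-- The mass function of `M_z`: it equals `w_v(x) / S_z(v)` on the patterns with bottom level `z` and
vanishes on the other patterns. -/
def gibbs {n : ℕ} (v : Fin n → ℝ) (z : WeylChamber n) (x : GTPattern n) : ℝ :=
  if x.bottom = z then weight v x / schur z.1 v else 0

/-! ### Push-block dynamics -/

/-- The particles that jump right when the particle `p` jumps right: `p` itself and, successively,
every `x^{j+1}_{i+1}` that is at the same position as an already moving `x^j_i`. -/
inductive MovesRight {n : ℕ} (x : GTIndex n → ℤ) (p : GTIndex n) : GTIndex n → Prop
  | self : MovesRight x p p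
  | push (q r : GTIndex n) : MovesRight x p q → q.BelowNext r → x q = x r → MovesRight x p r

/-- The particles that jump left when the particle `p` jumps left: `p` itself and, successively,
every `x^{j+1}_i` that is at the same position as an already moving `x^j_i`. -/
inductive MovesLeft {n : ℕ} (x : GTIndex n → ℤ) (p : GTIndex n) : GTIndex n → Prop
  | self : MovesLeft x p p
  | push (q r : GTIndex n) : MovesLeft x p q → q.Below r → x q = x r → MovesLeft x p r

/-- A right jump of `p = x^j_i` is suppressed: `x^j_i = x^{j-1}_i`. -/
def BlockedRight {n : ℕ} (x : GTIndex n → ℤ) (p : GTIndex n) : Prop :=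
  ∃ b : GTIndex n, b.Below p ∧ x p = x b

/-- A left jump of `p = x^j_i` is suppressed: `x^j_i = x^{j-1}_{i-1}`. -/
def BlockedLeft {n : ℕ} (x : GTIndex n → ℤ) (p : GTIndex n) : Prop :=
  ∃ b : GTIndex n, b.BelowNext p ∧ x p = x b

open Classical in
/-- The array after the right clock of the particle `p` has rung. -/
def rightArray {n : ℕ} (x : GTIndex n → ℤ) (p : GTIndex n) : GTIndex n → ℤ :=
  if BlockedRight x p then x else fun q => if MovesRight x p q then x q + 1 else x q

open Classical in
/-- The array after the left clock of the particle `p` has rung. -/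
def leftArray {n : ℕ} (x : GTIndex n → ℤ) (p : GTIndex n) : GTIndex n → ℤ :=
  if BlockedLeft x p then x else fun q => if MovesLeft x p q then x q - 1 else x q

theorem not_blockedRight_of_moves {n : ℕ} {x : GTIndex n → ℤ} (hx : IsGTPattern x)
    {p q : GTIndex n} (hp : ¬ BlockedRight x p) (hq : MovesRight x p q) : ¬ BlockedRight x q := by
  induction hq with
  | self => exact hp
  | push q r _ hqr he ih =>
    rintro ⟨b, hb, hrb⟩
    obtain ⟨h1, h2⟩ := hqr
    obtain ⟨h3, h4⟩ := hb
    have hbl : (b.1.2 : ℕ) ≤ b.1.1 := b.2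
    have hn := q.1.1.2
    let c : GTIndex n := ⟨(⟨q.1.1 - 1, by omega⟩, q.1.2), by
      show (q.1.2 : ℕ) ≤ q.1.1 - 1
      omega⟩
    have hcq : c.Below q := ⟨by simp only [c]; omega, rfl⟩
    have hcb : c.BelowNext b := ⟨by simp only [c]; omega, by simp only [c]; omega⟩
    have e1 := (hx c q).1 hcq
    have e2 := (hx c b).2 hcb
    exact ih ⟨c, hcq, by omega⟩

theorem not_blockedLeft_of_moves {n : ℕ} {x : GTIndex n → ℤ} (hx : IsGTPattern x)
    {p q : GTIndex n} (hp : ¬ BlockedLeft x p) (hq : MovesLeft x p q) : ¬ BlockedLeft x q := by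
  induction hq with
  | self => exact hp
  | push q r _ hqr he ih =>
    rintro ⟨b, hb, hrb⟩
    obtain ⟨h1, h2⟩ := hqr
    obtain ⟨h3, h4⟩ := hb
    have hbl : (b.1.2 : ℕ) ≤ b.1.1 := b.2
    have hql : (q.1.2 : ℕ) ≤ q.1.1 := q.2
    have hn := q.1.1.2
    let c : GTIndex n := ⟨(⟨q.1.1 - 1, by omega⟩, b.1.2), by
      show (b.1.2 : ℕ) ≤ q.1.1 - 1
      omega⟩
    have hcq : c.BelowNext q := ⟨by simp only [c]; omega, by simp only [c]; omega⟩
    have hcb : c.Below b := ⟨by simp only [c]; omega, rfl⟩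
    have e1 := (hx c q).2 hcq
    have e2 := (hx c b).1 hcb
    exact ih ⟨c, hcq, by omega⟩

theorem isGTPattern_rightArray {n : ℕ} {x : GTIndex n → ℤ} (hx : IsGTPattern x) (p : GTIndex n) :
    IsGTPattern (rightArray x p) := by
  unfold rightArray
  split_ifs with hb
  · exact hx
  refine fun q r => ⟨fun h => ?_, fun h => ?_⟩
  · have h1 := (hx q r).1 h
    have h2 : MovesRight x p r → x r ≠ x q := fun hr he =>
      not_blockedRight_of_moves hx hb hr ⟨q, h, he⟩
    dsimp only
    split_ifs with h3 h4 <;> first | omega | (have := h2 h3; omega)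
  · have h1 := (hx q r).2 h
    have h2 : MovesRight x p q → ¬ MovesRight x p r → x q ≠ x r := fun hq hr he =>
      hr (.push q r hq h he)
    dsimp only
    split_ifs with h3 h4 <;> first | omega | (have := h2 h3 h4; omega)

theorem isGTPattern_leftArray {n : ℕ} {x : GTIndex n → ℤ} (hx : IsGTPattern x) (p : GTIndex n) :
    IsGTPattern (leftArray x p) := by
  unfold leftArray
  split_ifs with hb
  · exact hx
  refine fun q r => ⟨fun h => ?_, fun h => ?_⟩
  · have h1 := (hx q r).1 h
    have h2 : MovesLeft x p q → ¬ MovesLeft x p r → x q ≠ x r := fun hq hr he =>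
      hr (.push q r hq h he)
    dsimp only
    split_ifs with h3 h4 <;> first | omega | (have := h2 ‹_› ‹_›; omega)
  · have h1 := (hx q r).2 h
    have h2 : MovesLeft x p r → x r ≠ x q := fun hr he =>
      not_blockedLeft_of_moves hx hb hr ⟨q, h, he⟩
    dsimp only
    split_ifs with h3 h4 <;> first | omega | (have := h2 ‹_›; omega)

/-- The pattern after the right clock of the particle `p` has rung. -/
def GTPattern.ringRight {n : ℕ} (x : GTPattern n) (p : GTIndex n) : GTPattern n :=
  ⟨rightArray x.1 p, isGTPattern_rightArray x.2 p⟩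

/-- The pattern after the left clock of the particle `p` has rung. -/
def GTPattern.ringLeft {n : ℕ} (x : GTPattern n) (p : GTIndex n) : GTPattern n :=
  ⟨leftArray x.1 p, isGTPattern_leftArray x.2 p⟩

open Classical in
/-- The `Q`-matrix of the push-block dynamics. Each particle on the `j`-th level has a right clock of
rate `v_j` and a left clock of rate `v_j⁻¹`, all of them independent; when a clock of rate `c` rings
and turns `x` into `x'`, this contributes `c * (1_{y = x'} - 1_{y = x})` to the entry `(x, y)`. -/
def pushBlockQ {n : ℕ} (v : Fin n → ℝ) (x y : GTPattern n) : ℝ :=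
  ∑ p : GTIndex n,
    (v p.1.1 * ((if y = x.ringRight p then 1 else 0) - if y = x then 1 else 0) +
      (v p.1.1)⁻¹ * ((if y = x.ringLeft p then 1 else 0) - if y = x then 1 else 0))

end

/-! ### Sums over finite fibres -/

/-! The argument is the Rogers–Pitman criterion. Let `Λ` be the kernel that sends a bottom row `z`
to the measure `M_z`. If `Λ Q = R Λ`, with `Q` the push-block matrix and `R` the Schur matrix, then
conditionally on the current bottom row the pattern keeps the law `M`. This makes the bottom row
Markov with generator `R`.

Passing from generators to transition functions (`Intertwining.averaged_eq`) is a uniqueness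
argument. Each column of `Λ P_t` solves the backward equation `u' = R u`. The diagonal of `R` is
bounded, so `R` is bounded on bounded functions, and a bounded solution that starts at zero vanishes
(`eq_zero_of_bounded_linear_ode`). Summing finite-dimensional distributions over fibres then gives
the Markov property (`Intertwining.isMarkov_comp`).

Two combinatorial facts give the generator identity. First, `S_z(v)` is the total weight of the
patterns with bottom row `z` (`schur_eq_sum_weight`), by the branching rule for alternants. Second,
the weighted inflow into a pattern `y` is explicit (`sum_weight_ringRight`). A right jump that
starts at level `j` and pushes down to level `k` raises one particle on each level from `j` to `k`,
so it multiplies the weight by `v_j / v_{k+1}`. Relative to `w(y)`, its contribution is therefore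
`v_{k+1}`, the rate of the particle below the last one moved. Such a jump can be undone exactly when
that lower particle is not blocked in `y`. Hence jumps that keep the bottom row, together with
suppressed ones, contribute the configuration-free total of `v_j` over particles with `i < j`.
Subtracting the total clock rate leaves `-∑ v_j`. Jumps that reach the bottom contribute `1`. Left
jumps follow by reflection (`sum_weight_ringLeft`). -/

theorem hasSum_sum_fiber {S T : Type*} {π : S → T} {fib : T → Finset S}
    (hfib : ∀ z x, x ∈ fib z ↔ π x = z) {f : S → ℝ} {a : ℝ} (h : HasSum f a) :
    HasSum (fun z => ∑ x ∈ fib z, f x) a := by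
  have h' := ((Equiv.sigmaFiberEquiv π).hasSum_iff (f := f)).2 h
  refine h'.sigma fun z => ?_
  have h2 := (fib z).hasSum f
  exact ((Equiv.subtypeEquivRight (fun x => hfib z x)).hasSum_iff
    (f := fun c : {x // π x = z} => f c)).1 h2

/-! ### Transition functions and the backward equation -/

namespace IsTransitionFunction

variable {S : Type*} {P : ℝ≥0 → S → S → ℝ} {Q : S → S → ℝ}

theorem le_one (hP : IsTransitionFunction P) (t : ℝ≥0) (x y : S) : P t x y ≤ 1 :=
  le_hasSum (hP.hasSum_one t x) y fun _ _ => hP.nonneg _ _ _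

theorem sum_mul_le (hP : IsTransitionFunction P) (F : Finset S) (h s : ℝ≥0) (x z : S) :
    ∑ y ∈ F, P h x y * P s y z ≤ P (h + s) x z :=
  sum_le_hasSum F (fun _ _ => mul_nonneg (hP.nonneg _ _ _) (hP.nonneg _ _ _))
    (hP.chapman_kolmogorov h s x z)

/-- Outside `F` the second factor is at most `1`, so truncating Chapman–Kolmogorov to `F` loses at
most the mass that `P h x` puts outside `F`. Together with `sum_mul_le` this replaces any exchange
of a limit with an infinite sum. -/
theorem le_sum_mul_add (hP : IsTransitionFunction P) (F : Finset S) (h s : ℝ≥0) (x z : S) :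
    P (h + s) x z ≤ ∑ y ∈ F, P h x y * P s y z + (1 - ∑ y ∈ F, P h x y) := by
  have h1 := (hP.hasSum_one h x).sub (hP.chapman_kolmogorov h s x z)
  have h2 := sum_le_hasSum F (fun y _ => by
    have := mul_le_of_le_one_right (hP.nonneg h x y) (hP.le_one s y z)
    linarith) h1
  rw [Finset.sum_sub_distrib] at h2
  linarith

theorem abs_add_sub_le (hP : IsTransitionFunction P) (h s : ℝ≥0) (x z : S) :
    |P (h + s) x z - P s x z| ≤ 1 - P h x x := by
  have h1 := hP.sum_mul_le {x} h s x z
  have h2 := hP.le_sum_mul_add {x} h s x z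
  rw [Finset.sum_singleton] at h1 h2
  rw [Finset.sum_singleton] at h2
  have a1 := hP.le_one h x x
  have b0 := hP.nonneg s x z
  have b1 := hP.le_one s x z
  rw [abs_le]
  constructor <;> nlinarith

/-- A finite derivative at `0` forces continuity there; standardness of `P` need not be assumed
separately. -/
theorem tendsto_self (hP : IsTransitionFunction P) (hQ : HasQMatrix P Q) (x : S) :
    Tendsto (fun h => P h x x) (𝓝 0) (𝓝 1) := by
  have h1 : Tendsto (fun h => P h x x) (𝓝[>] 0) (𝓝 1) := by
    have h2 := hQ x x
    have h3 : Tendsto (fun h : ℝ≥0 => (h : ℝ)) (𝓝[>] 0) (𝓝 0) :=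
      (NNReal.continuous_coe.tendsto 0).mono_left nhdsWithin_le_nhds
    have h4 := (h2.mul h3).add_const 1
    rw [mul_zero, zero_add] at h4
    refine h4.congr' ?_
    filter_upwards [self_mem_nhdsWithin] with h hh
    have hh' : (h : ℝ) ≠ 0 := by exact_mod_cast (ne_of_gt hh)
    rw [if_pos rfl]
    field_simp
    ring
  have h5 : (𝓝 (0 : ℝ≥0)) = 𝓝[>] 0 ⊔ pure 0 := by
    rw [sup_comm, ← nhdsNE_sup_pure, sup_comm]
    congr 2
    ext t
    simp [pos_iff_ne_zero]
  rw [h5, tendsto_sup]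
  refine ⟨h1, ?_⟩
  rw [tendsto_pure_left]
  intro s hs
  rw [hP.zero_self]
  exact mem_of_mem_nhds hs

/-- By `abs_add_sub_le` the increment between two times is at most `1 - P h x x`, where `h` is their
distance. The bound is symmetric in the two times, so continuity holds on both sides. -/
theorem continuous (hP : IsTransitionFunction P) (hQ : HasQMatrix P Q) (x z : S) :
    Continuous fun t => P t x z := by
  rw [continuous_iff_continuousAt]
  intro t
  rw [ContinuousAt, tendsto_iff_dist_tendsto_zero]
  have h1 : Tendsto (fun u => 1 - P (nndist u t) x x) (𝓝 t) (𝓝 0) := by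
    have h2 : Tendsto (fun u => nndist u t) (𝓝 t) (𝓝 0) := by
      have : Continuous fun u => nndist u t := by fun_prop
      simpa using this.tendsto t
    simpa using ((hP.tendsto_self hQ x).comp h2).const_sub 1
  refine squeeze_zero (fun _ => dist_nonneg) (fun u => ?_) h1
  rw [Real.dist_eq]
  rcases le_total u t with h | h
  · have e : nndist u t + u = t := by
      rw [NNReal.nndist_eq, tsub_eq_zero_of_le h, max_eq_right (zero_le), tsub_add_cancel_of_le h]
    have := hP.abs_add_sub_le (nndist u t) u x z
    rw [e] at this
    rwa [abs_sub_comm]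
  · have e : nndist u t + t = u := by
      rw [NNReal.nndist_eq, tsub_eq_zero_of_le h, max_eq_left (zero_le), tsub_add_cancel_of_le h]
    have := hP.abs_add_sub_le (nndist u t) t x z
    rwa [e] at this

open Classical in
/-- Kolmogorov's backward equation, for a row of `Q` that is conservative with finite support. -/
theorem tendsto_backward (hP : IsTransitionFunction P) (hQ : HasQMatrix P Q) (x z : S)
    (F : Finset S) (hx : x ∈ F) (hF : ∑ y ∈ F, Q x y = 0) (s : ℝ≥0) :
    Tendsto (fun h : ℝ≥0 => (P (h + s) x z - P s x z) / (h : ℝ)) (𝓝[>] 0)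
      (𝓝 (∑ y ∈ F, Q x y * P s y z)) := by
  -- Since the row sums to zero on `F`, the probability of being outside `F` at time `h` is `o(h)`.
  -- This makes the two truncation bounds agree in the limit.
  have h1 : Tendsto (fun h : ℝ≥0 => ∑ y ∈ F, (P h x y - if x = y then 1 else 0) / (h : ℝ))
      (𝓝[>] 0) (𝓝 0) := by
    have := tendsto_finsetSum F fun y _ => hQ x y
    rwa [hF] at this
  have h2 : Tendsto (fun h : ℝ≥0 =>
      ∑ y ∈ F, (P h x y - if x = y then 1 else 0) / (h : ℝ) * P s y z)
      (𝓝[>] 0) (𝓝 (∑ y ∈ F, Q x y * P s y z)) :=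
    tendsto_finsetSum _ fun y _ => (hQ x y).mul_const _
  have h3 := h2.sub h1
  rw [sub_zero] at h3
  have e1 : ∀ h : ℝ≥0, ∑ y ∈ F, (P h x y - if x = y then 1 else 0) / (h : ℝ) =
      (∑ y ∈ F, P h x y - 1) / h := by
    intro h
    rw [← Finset.sum_div, Finset.sum_sub_distrib, Finset.sum_ite_eq, if_pos hx]
  have e2 : ∀ h : ℝ≥0, ∑ y ∈ F, (P h x y - if x = y then 1 else 0) / (h : ℝ) * P s y z =
      (∑ y ∈ F, P h x y * P s y z - P s x z) / h := by
    intro h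
    simp only [div_mul_eq_mul_div, sub_mul, ite_mul, one_mul, zero_mul]
    rw [← Finset.sum_div, Finset.sum_sub_distrib, Finset.sum_ite_eq, if_pos hx]
  refine tendsto_of_tendsto_of_tendsto_of_le_of_le h2 h3 (fun h => ?_) (fun h => ?_)
  · simp only [e2]
    have := hP.sum_mul_le F h s x z
    gcongr
  · simp only [e1, e2]
    rw [← sub_div]
    have := hP.le_sum_mul_add F h s x z
    exact div_le_div_of_nonneg_right (by linarith) h.2

/-- Only the right derivative is obtained, because the increments `h` are positive. With continuity
it suffices for the mean value inequality used below. -/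
theorem hasDerivWithinAt (hP : IsTransitionFunction P) (hQ : HasQMatrix P Q) (x z : S)
    (F : Finset S) (hx : x ∈ F) (hF : ∑ y ∈ F, Q x y = 0) (s : ℝ≥0) :
    HasDerivWithinAt (fun r : ℝ => P r.toNNReal x z) (∑ y ∈ F, Q x y * P s y z)
      (Set.Ici (s : ℝ)) s := by
  rw [← hasDerivWithinAt_Ioi_iff_Ici, hasDerivWithinAt_iff_tendsto_slope' (by simp)]
  have h1 : Tendsto (fun r : ℝ => (r - s).toNNReal) (𝓝[>] (s : ℝ)) (𝓝[>] 0) := by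
    refine tendsto_nhdsWithin_iff.2 ⟨?_, ?_⟩
    · have : Continuous fun r : ℝ => (r - s).toNNReal := by fun_prop
      have h2 := this.tendsto (s : ℝ)
      simp only [sub_self, Real.toNNReal_zero] at h2
      exact h2.mono_left nhdsWithin_le_nhds
    · filter_upwards [self_mem_nhdsWithin] with r hr
      simpa using hr
  refine ((hP.tendsto_backward hQ x z F hx hF s).comp h1).congr' ?_
  filter_upwards [self_mem_nhdsWithin] with r hr
  have hr' : (s : ℝ) < r := hr
  have e : (r - s).toNNReal + s = r.toNNReal := by
    apply NNReal.coe_injective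
    rw [NNReal.coe_add, Real.coe_toNNReal _ (by linarith), Real.coe_toNNReal _ (s.2.trans hr'.le)]
    ring
  simp only [Function.comp_apply, slope_def_field, e, Real.toNNReal_coe]
  rw [Real.coe_toNNReal _ (by linarith)]

end IsTransitionFunction

/-! ### Uniqueness of bounded solutions of the backward equation -/

/-- Gronwall by iteration: a bound on all coordinates, inserted into the equation and integrated,
improves by a factor `C t / (k + 1)`, and `(C t) ^ k / k!` tends to `0`. -/
theorem eq_zero_of_bounded_linear_ode {T : Type*} {u u' : ℝ → T → ℝ} {B C : ℝ}
    (hcont : ∀ z, Continuous fun t => u t z)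
    (hder : ∀ t, 0 ≤ t → ∀ z, HasDerivWithinAt (fun r => u r z) (u' t z) (Set.Ici t) t)
    (hlin : ∀ t, 0 ≤ t → ∀ b, (∀ z, |u t z| ≤ b) → ∀ z, |u' t z| ≤ C * b)
    (hB : ∀ t, 0 ≤ t → ∀ z, |u t z| ≤ B) (h0 : ∀ z, u 0 z = 0) (t : ℝ) (ht : 0 ≤ t) (z : T) :
    u t z = 0 := by
  have key : ∀ (k : ℕ) (t : ℝ), 0 ≤ t → ∀ z, |u t z| ≤ B * ((C * t) ^ k / k.factorial) := by
    intro k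
    induction k with
    | zero => intro t ht z; simpa using hB t ht z
    | succ k ih =>
      intro t ht z
      have hd : ∀ x : ℝ, HasDerivAt (fun s => B * ((C * s) ^ (k + 1) / (k + 1).factorial))
          (C * (B * ((C * x) ^ k / k.factorial))) x := by
        intro x
        have h1 : HasDerivAt (fun s => C * s) C x := by
          simpa using (hasDerivAt_id x).const_mul C
        have h2 := ((h1.pow (k + 1)).div_const ((k + 1).factorial : ℝ)).const_mul B
        refine h2.congr_deriv ?_
        rw [Nat.factorial_succ]
        push_cast
        have : (k.factorial : ℝ) ≠ 0 := by positivity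
        field_simp
      -- The derivative of the new bound is exactly `C` times the previous one, which is what `hlin`
      -- gives for `u'`.
      have := image_norm_le_of_norm_deriv_right_le_deriv_boundary (f := fun s => u s z)
        (f' := fun s => u' s z) (a := 0) (b := t) (hcont z).continuousOn
        (fun x hx => hder x hx.1 z)
        (B := fun s => B * ((C * s) ^ (k + 1) / (k + 1).factorial)) (by simp [h0]) hd
        (fun x hx => hlin x hx.1 _ (ih x hx.1) z) (Set.right_mem_Icc.2 ht)
      simpa using this
  have hlim : Tendsto (fun k : ℕ => B * ((C * t) ^ k / k.factorial)) atTop (𝓝 0) := by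
    simpa using (FloorSemiring.tendsto_pow_div_factorial_atTop (C * t)).const_mul B
  have := ge_of_tendsto' hlim fun k => key k t ht z
  exact abs_nonpos_iff.1 this

/-! ### Markov functions -/

/-- The data of the Rogers–Pitman criterion for the function `π` of a Markov process with `Q`-matrix
`Q`: on each (finite) fibre of `π`, `κ` is a probability mass function, and the resulting kernel
from `T` to `S` intertwines `R` and `Q`. -/
structure Intertwining {S T : Type*} (π : S → T) (fib : T → Finset S) (κ : S → ℝ)
    (Q : S → S → ℝ) (R : T → T → ℝ) : Prop where
  mem_fib : ∀ z x, x ∈ fib z ↔ π x = z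
  nonneg : ∀ x, 0 ≤ κ x
  sum_one : ∀ z, ∑ x ∈ fib z, κ x = 1
  conservative : IsConservativeQMatrix Q
  finite_rows : ∀ x, {y | Q x y ≠ 0}.Finite
  bounded : ∃ c, ∀ z, -R z z ≤ c
  intertwine : ∀ z y, ∑ x ∈ fib z, κ x * Q x y = R z (π y) * κ y

namespace Intertwining

variable {S T : Type*} {π : S → T} {fib : T → Finset S} {κ : S → ℝ} {Q : S → S → ℝ}
  {R : T → T → ℝ} {P : ℝ≥0 → S → S → ℝ}

theorem apply_eq_sum (I : Intertwining π fib κ Q R) (z z' : T) :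
    R z z' = ∑ y ∈ fib z', ∑ x ∈ fib z, κ x * Q x y := by
  rw [← mul_one (R z z'), ← I.sum_one z', Finset.mul_sum]
  refine Finset.sum_congr rfl fun y hy => ?_
  rw [I.intertwine, (I.mem_fib z' y).1 hy]

/-- Summed over target fibres, the intertwining writes each row of `R` as a `κ`-average of rows of
`Q`, lumped by fibre; signs and row sums are inherited. -/
theorem isConservativeQMatrix (I : Intertwining π fib κ Q R) : IsConservativeQMatrix R := by
  refine ⟨fun z z' hz => ?_, fun z => ?_⟩
  · rw [I.apply_eq_sum]
    refine Finset.sum_nonneg fun y hy => Finset.sum_nonneg fun x hx =>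
      mul_nonneg (I.nonneg x) (I.conservative.1 x y ?_)
    rintro rfl
    rw [I.mem_fib] at hx hy
    exact hz (hx.symm.trans hy)
  · have h1 : HasSum (fun y => ∑ x ∈ fib z, κ x * Q x y) (∑ x ∈ fib z, κ x * 0) :=
      hasSum_sum fun x _ => (I.conservative.2 x).mul_left _
    have h2 := hasSum_sum_fiber I.mem_fib h1
    simpa only [← I.apply_eq_sum, mul_zero, Finset.sum_const_zero] using h2

/-- A conservative row has absolute sum `-2 R z z`, so the bound on the diagonal controls `R` as an
operator on bounded functions. -/
theorem abs_hasSum_le (I : Intertwining π fib κ Q R) :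
    ∃ C, 0 ≤ C ∧ ∀ (z : T) (u : T → ℝ) (b D : ℝ), (∀ w, |u w| ≤ b) →
      HasSum (fun w => R z w * u w) D → |D| ≤ C * b := by
  classical
  obtain ⟨c, hc⟩ := I.bounded
  have hR := I.isConservativeQMatrix
  refine ⟨2 * max c 0, by positivity, fun z u b D hu hD => ?_⟩
  have h1 : HasSum (fun w => |R z w|) (0 + 2 * (-R z z)) := by
    have h2 := (hR.2 z).add ((hasSum_ite_eq z (-R z z)).mul_left 2)
    have hz : R z z ≤ 0 := by
      have := sum_le_hasSum (f := fun w => if w = z then 0 else R z w) ∅ (fun w _ => by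
        split_ifs with h
        · exact le_rfl
        · exact hR.1 z w (Ne.symm h)) (a := 0 + -R z z) (by
        refine ((hR.2 z).add (hasSum_ite_eq z (-R z z))).congr_fun ?_
        intro w
        by_cases h : w = z
        · subst h; simp
        · simp [h])
      simp at this
      exact this
    refine h2.congr_fun ?_
    intro w
    by_cases h : w = z
    · subst h
      simp only [if_true]
      rw [abs_of_nonpos hz]
      ring
    · simp only [h, if_false]
      rw [abs_of_nonneg (hR.1 z w (Ne.symm h))]
      ring
  have hb : 0 ≤ b := (abs_nonneg _).trans (hu z)
  have h3 : ∀ w, |R z w * u w| ≤ |R z w| * b := fun w => by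
    rw [abs_mul]
    exact mul_le_mul_of_nonneg_left (hu w) (abs_nonneg _)
  have h4 := h1.mul_right b
  have h5 : D ≤ (0 + 2 * (-R z z)) * b := hasSum_le (fun w => (abs_le.1 (h3 w)).2) hD h4
  have h6 : -((0 + 2 * (-R z z)) * b) ≤ D :=
    hasSum_le (fun w => (abs_le.1 (h3 w)).1) h4.neg hD
  have h7 : (0 + 2 * (-R z z)) * b ≤ 2 * max c 0 * b := by
    refine mul_le_mul_of_nonneg_right ?_ hb
    have := hc z
    have := le_max_left c 0
    linarith
  rw [abs_le]
  constructor <;> linarith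

end Intertwining

/-- The kernel `Λ P_t` from `T` to `S`, where `Λ` is given by `κ` on the fibres. -/
noncomputable def averaged {S T : Type*} (fib : T → Finset S) (κ : S → ℝ) (P : ℝ≥0 → S → S → ℝ)
    (t : ℝ≥0) (z : T) (y : S) : ℝ :=
  ∑ x ∈ fib z, κ x * P t x y

/-- The transition function induced on `T`. -/
noncomputable def projected {S T : Type*} (fib : T → Finset S) (κ : S → ℝ) (P : ℝ≥0 → S → S → ℝ)
    (t : ℝ≥0) (z z' : T) : ℝ :=
  ∑ y ∈ fib z', averaged fib κ P t z y

namespace Intertwining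

variable {S T : Type*} {π : S → T} {fib : T → Finset S} {κ : S → ℝ} {Q : S → S → ℝ}
  {R : T → T → ℝ} {P : ℝ≥0 → S → S → ℝ}

theorem averaged_nonneg (I : Intertwining π fib κ Q R) (hP : IsTransitionFunction P) (t : ℝ≥0)
    (z : T) (y : S) : 0 ≤ averaged fib κ P t z y :=
  Finset.sum_nonneg fun x _ => mul_nonneg (I.nonneg x) (hP.nonneg _ _ _)

theorem averaged_le_one (I : Intertwining π fib κ Q R) (hP : IsTransitionFunction P) (t : ℝ≥0)
    (z : T) (y : S) : averaged fib κ P t z y ≤ 1 := by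
  rw [← I.sum_one z]
  exact Finset.sum_le_sum fun x _ => mul_le_of_le_one_right (I.nonneg x) (hP.le_one _ _ _)

open Classical in
theorem averaged_zero (I : Intertwining π fib κ Q R) (hP : IsTransitionFunction P) (z : T) (y : S) :
    averaged fib κ P 0 z y = if π y = z then κ y else 0 := by
  have h : ∀ x, P 0 x y = if x = y then 1 else 0 := fun x => by
    split_ifs with h
    · subst h; exact hP.zero_self x
    · exact hP.zero_of_ne x y h
  simp only [averaged, h, mul_ite, mul_one, mul_zero, Finset.sum_ite_eq', I.mem_fib]

open Classical in
theorem projected_zero (I : Intertwining π fib κ Q R) (hP : IsTransitionFunction P) (z z' : T) :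
    projected fib κ P 0 z z' = if z = z' then 1 else 0 := by
  simp only [projected, I.averaged_zero hP]
  split_ifs with h
  · subst h
    rw [← I.sum_one z]
    exact Finset.sum_congr rfl fun y hy => if_pos ((I.mem_fib z y).1 hy)
  · exact Finset.sum_eq_zero fun y hy => if_neg fun h' => h (h'.symm.trans ((I.mem_fib z' y).1 hy))

theorem continuous_averaged (hP : IsTransitionFunction P)
    (hQ : HasQMatrix P Q) (z : T) (y : S) : Continuous fun t => averaged fib κ P t z y :=
  continuous_finsetSum _ fun x _ => (hP.continuous hQ x y).const_mul _

/-- This is `(Λ P)' = Λ Q P = R Λ P`: the backward equation for each `x` in the finite fibre,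
followed by regrouping the sum over intermediate states by fibre. The right side is a `HasSum`
because rows of `R` are not assumed to be finitely supported. -/
theorem hasDerivWithinAt_averaged (I : Intertwining π fib κ Q R) (hP : IsTransitionFunction P)
    (hQ : HasQMatrix P Q) (z : T) (y : S) (s : ℝ≥0) :
    ∃ D, HasDerivWithinAt (fun r : ℝ => averaged fib κ P r.toNNReal z y) D (Set.Ici (s : ℝ)) s ∧
      HasSum (fun w => R z w * averaged fib κ P s w y) D := by
  classical
  let F : S → Finset S := fun x => insert x (I.finite_rows x).toFinset
  have hF0 : ∀ x y, y ∉ F x → Q x y = 0 := fun x y hy => by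
    by_contra h
    exact hy (Finset.mem_insert_of_mem ((I.finite_rows x).mem_toFinset.2 h))
  have hF : ∀ x, ∑ y ∈ F x, Q x y = 0 := fun x =>
    (hasSum_sum_of_ne_finset_zero fun y hy => hF0 x y hy).unique (I.conservative.2 x)
  refine ⟨∑ x ∈ fib z, κ x * ∑ w ∈ F x, Q x w * P s w y, ?_, ?_⟩
  · exact HasDerivWithinAt.fun_sum fun x _ =>
      (hP.hasDerivWithinAt hQ x y (F x) (Finset.mem_insert_self _ _) (hF x) s).const_mul _
  · have h1 : ∀ x, HasSum (fun w => Q x w * P s w y) (∑ w ∈ F x, Q x w * P s w y) := fun x =>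
      hasSum_sum_of_ne_finset_zero fun w hw => by rw [hF0 x w hw, zero_mul]
    have h2 : HasSum (fun w => ∑ x ∈ fib z, κ x * (Q x w * P s w y))
        (∑ x ∈ fib z, κ x * ∑ w ∈ F x, Q x w * P s w y) :=
      hasSum_sum fun x _ => (h1 x).mul_left _
    have h3 := hasSum_sum_fiber I.mem_fib h2
    refine h3.congr_fun fun w => ?_
    rw [averaged, Finset.mul_sum]
    refine Finset.sum_congr rfl fun x hx => ?_
    simp only [← mul_assoc]
    rw [← Finset.sum_mul, I.intertwine, (I.mem_fib w x).1 hx]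

/-- The intertwining of the transition functions. -/
theorem averaged_eq (I : Intertwining π fib κ Q R) (hP : IsTransitionFunction P)
    (hQ : HasQMatrix P Q) (t : ℝ≥0) (z : T) (y : S) :
    averaged fib κ P t z y = projected fib κ P t z (π y) * κ y := by
  classical
  choose D hD hDs using fun (s : ℝ≥0) z x => I.hasDerivWithinAt_averaged hP hQ z x s
  obtain ⟨C, hC0, hC⟩ := I.abs_hasSum_le
  -- For fixed `y`, this is the defect of the claim as a function of the starting point. It is a
  -- fixed linear combination of columns of `Λ P`, so it solves the same linear equation.
  set u : ℝ → T → ℝ := fun r z => averaged fib κ P r.toNNReal z y -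
    (∑ x ∈ fib (π y), averaged fib κ P r.toNNReal z x) * κ y with hu
  have h := eq_zero_of_bounded_linear_ode (u := u)
    (u' := fun r z => D r.toNNReal z y - (∑ x ∈ fib (π y), D r.toNNReal z x) * κ y)
    (B := 1 + (∑ x ∈ fib (π y), 1) * κ y) (C := C) ?_ ?_ ?_ ?_ ?_ t t.2 z
  · simp only [hu, Real.toNNReal_coe] at h
    exact sub_eq_zero.1 h
  · intro z
    exact ((continuous_averaged hP hQ z y).comp continuous_real_toNNReal).sub
      ((continuous_finsetSum _ fun x _ =>
        (continuous_averaged hP hQ z x).comp continuous_real_toNNReal).mul_const _)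
  · intro t ht z
    lift t to ℝ≥0 using ht
    simp only [Real.toNNReal_coe]
    exact (hD t z y).sub ((HasDerivWithinAt.fun_sum fun x _ => hD t z x).mul_const _)
  · intro t ht b hb z
    refine hC z (u t) b _ hb ?_
    have := (hDs t.toNNReal z y).sub
      ((hasSum_sum (s := fib (π y)) fun x _ => hDs t.toNNReal z x).mul_right (κ y))
    refine this.congr_fun fun w => ?_
    simp only [hu]
    rw [mul_sub, ← Finset.mul_sum, mul_assoc]
  · intro t _ z
    refine (abs_sub _ _).trans (add_le_add ?_ ?_)
    · rw [abs_of_nonneg (I.averaged_nonneg hP _ _ _)]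
      exact I.averaged_le_one hP _ _ _
    · rw [abs_of_nonneg (mul_nonneg
        (Finset.sum_nonneg fun x _ => I.averaged_nonneg hP _ _ _) (I.nonneg y))]
      exact mul_le_mul_of_nonneg_right
        (Finset.sum_le_sum fun x _ => I.averaged_le_one hP _ _ _) (I.nonneg y)
  · intro z
    simp only [hu, Real.toNNReal_zero]
    have h1 := I.projected_zero hP z (π y)
    rw [projected] at h1
    rw [h1, I.averaged_zero hP]
    by_cases h : z = π y
    · subst h; simp
    · simp [h, Ne.symm h]

theorem isTransitionFunction (I : Intertwining π fib κ Q R) (hP : IsTransitionFunction P)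
    (hQ : HasQMatrix P Q) : IsTransitionFunction (projected fib κ P) where
  nonneg t z z' := Finset.sum_nonneg fun y _ => I.averaged_nonneg hP t z y
  hasSum_one t z := by
    have h1 : HasSum (fun y => averaged fib κ P t z y) (∑ x ∈ fib z, κ x * 1) :=
      hasSum_sum fun x _ => (hP.hasSum_one t x).mul_left _
    have h2 := hasSum_sum_fiber I.mem_fib h1
    simp only [mul_one, I.sum_one] at h2
    exact h2
  zero_self z := by simp [I.projected_zero hP]
  zero_of_ne z z' h := by simp [I.projected_zero hP, h]
  chapman_kolmogorov s t z z' := by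
    have h1 : HasSum (fun w => ∑ y ∈ fib z', averaged fib κ P s z w * P t w y)
        (projected fib κ P (s + t) z z') := by
      refine hasSum_sum fun y _ => ?_
      have h2 : HasSum (fun w => ∑ x ∈ fib z, κ x * (P s x w * P t w y))
          (averaged fib κ P (s + t) z y) :=
        hasSum_sum fun x _ => (hP.chapman_kolmogorov s t x y).mul_left _
      refine h2.congr_fun fun w => ?_
      rw [averaged, Finset.sum_mul]
      exact Finset.sum_congr rfl fun x _ => by ring
    refine (hasSum_sum_fiber I.mem_fib h1).congr_fun fun w => ?_
    rw [Finset.sum_comm, projected.eq_def fib κ P t, Finset.mul_sum]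
    refine Finset.sum_congr rfl fun y _ => ?_
    rw [averaged.eq_def fib κ P t, Finset.mul_sum]
    refine Finset.sum_congr rfl fun x hx => ?_
    -- On the fibre over `w`, the law at time `s` is a multiple of `κ`, so the evolution can restart
    -- from `w` alone.
    rw [I.averaged_eq hP hQ, (I.mem_fib w x).1 hx, mul_assoc]

theorem hasQMatrix (I : Intertwining π fib κ Q R) (hP : IsTransitionFunction P)
    (hQ : HasQMatrix P Q) : HasQMatrix (projected fib κ P) R := by
  classical
  intro z z'
  rw [I.apply_eq_sum z z']
  have h1 : Tendsto (fun h : ℝ≥0 => ∑ y ∈ fib z', ∑ x ∈ fib z,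
      κ x * ((P h x y - if x = y then 1 else 0) / (h : ℝ))) (𝓝[>] 0)
      (𝓝 (∑ y ∈ fib z', ∑ x ∈ fib z, κ x * Q x y)) :=
    tendsto_finsetSum _ fun y _ => tendsto_finsetSum _ fun x _ => (hQ x y).const_mul _
  refine h1.congr fun h => ?_
  have h0 := I.projected_zero hP z z'
  have e : ∀ x y, P 0 x y = if x = y then 1 else 0 := fun x y => by
    split_ifs with h
    · subst h; exact hP.zero_self x
    · exact hP.zero_of_ne x y h
  rw [show (if z = z' then (1 : ℝ) else 0) = projected fib κ P 0 z z' by rw [h0]]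
  simp only [projected, averaged, e, mul_div_assoc']
  simp only [← Finset.sum_div, mul_sub, Finset.sum_sub_distrib]

/-- The finite-dimensional weights of the induced process. -/
theorem sum_prod (I : Intertwining π fib κ Q R) (hP : IsTransitionFunction P)
    (hQ : HasQMatrix P Q) (m : ℕ) (d : Fin m → ℝ≥0) (z : Fin (m + 1) → T) :
    ∑ x ∈ Fintype.piFinset (fun i => fib (z i)),
        κ (x 0) * ∏ i : Fin m, P (d i) (x i.castSucc) (x i.succ) =
      ∏ i : Fin m, projected fib κ P (d i) (z i.castSucc) (z i.succ) := by
  classical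
  induction m with
  | zero =>
    simp only [Finset.univ_eq_empty, Finset.prod_empty, mul_one]
    rw [← I.sum_one (z 0)]
    refine Finset.sum_nbij' (fun x => x 0) (fun a _ => a) ?_ ?_ ?_ ?_ ?_
    · intro x hx
      exact Fintype.mem_piFinset.1 hx 0
    · intro a ha
      refine Fintype.mem_piFinset.2 fun i => ?_
      rwa [Fin.fin_one_eq_zero i]
    · intro x _
      funext i
      rw [Fin.fin_one_eq_zero i]
    · intro a _; rfl
    · intro x _; rfl
  | succ m ih =>
    have ih' := ih (fun i => d i.succ) (fun i => z i.succ)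
    simp only [Fin.succ_castSucc] at ih'
    rw [Fin.prod_univ_succ, ← ih', Finset.mul_sum]
    have h1 : ∑ x ∈ Fintype.piFinset (fun i => fib (z i)),
        κ (x 0) * ∏ i : Fin (m + 1), P (d i) (x i.castSucc) (x i.succ) =
        ∑ p ∈ Fintype.piFinset (fun i => fib (z (Fin.succ i))) ×ˢ fib (z 0),
          κ p.2 * (P (d 0) p.2 (p.1 0) *
            ∏ i : Fin m, P (d i.succ) (p.1 i.castSucc) (p.1 i.succ)) := by
      refine Finset.sum_nbij' (fun x => (fun i => x i.succ, x 0))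
        (fun p => Fin.cons p.2 p.1) ?_ ?_ ?_ ?_ ?_
      · intro x hx
        rw [Fintype.mem_piFinset] at hx
        exact Finset.mem_product.2 ⟨Fintype.mem_piFinset.2 fun i => hx i.succ, hx 0⟩
      · intro p hp
        rw [Finset.mem_product, Fintype.mem_piFinset] at hp
        refine Fintype.mem_piFinset.2 fun i => ?_
        refine Fin.cases ?_ (fun i => ?_) i
        · exact hp.2
        · exact hp.1 i
      · intro x _
        funext i
        refine Fin.cases rfl (fun i => rfl) i
      · intro p _; rfl
      · intro x _
        rw [Fin.prod_univ_succ]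
        rfl
    rw [h1, Finset.sum_product]
    refine Finset.sum_congr rfl fun x hx => ?_
    -- Summing out the first state leaves a projected transition times `κ` at the next state, which
    -- is the form required by the induction hypothesis.
    have hx0 : π (x 0) = z (Fin.succ 0) := (I.mem_fib _ _).1 (Fintype.mem_piFinset.1 hx 0)
    have h2 := I.averaged_eq hP hQ (d 0) (z 0) (x 0)
    rw [hx0, averaged] at h2
    simp only [← mul_assoc]
    rw [← Finset.sum_mul, h2]
    rfl

/-- At every fixed time the law on a fibre is proportional to `κ`, by `averaged_eq`. The
finite-dimensional distributions of `X`, summed over a product of fibres, therefore factor through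
`sum_prod`, even when the first observation time is positive. -/
theorem isMarkov_comp (I : Intertwining π fib κ Q R) {Ω : Type*} [MeasurableSpace Ω]
    (μ : Measure Ω) [IsProbabilityMeasure μ] (X : ℝ≥0 → Ω → S) (hX : IsMarkovProcess μ X Q)
    (z : T) (hX0 : ∀ x ∈ fib z, μ.real {ω | X 0 ω = x} = κ x) :
    IsMarkovProcess μ (fun t ω => π (X t ω)) R := by
  classical
  obtain ⟨hmeas, hpath, P, hP, hQ, hfd⟩ := hX
  have hset : ∀ t s, {ω | π (X t ω) = s} = ⋃ x ∈ fib s, {ω | X t ω = x} := by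
    intro t s
    ext ω
    simp [I.mem_fib]
  refine ⟨?_, ?_, projected fib κ P, I.isTransitionFunction hP hQ, I.hasQMatrix hP hQ, ?_⟩
  · intro t s
    rw [hset]
    exact Finset.measurableSet_biUnion _ fun x _ => hmeas t x
  · filter_upwards [hpath] with ω hω t
    filter_upwards [hω t] with u hu
    rw [hu]
  have hfin : ∀ t s, μ.real {ω | π (X t ω) = s} = ∑ x ∈ fib s, μ.real {ω | X t ω = x} := by
    intro t s
    rw [hset]
    refine measureReal_biUnion_finset ?_ fun x _ => hmeas t x
    intro x _ y _ hxy
    exact Set.disjoint_left.2 fun ω h1 h2 => hxy (h1.symm.trans h2)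
  -- The initial law is prescribed only on one fibre, but it has total mass one there, so the other
  -- fibres are null.
  have hstart : μ.real {ω | π (X 0 ω) = z} = 1 := by
    rw [hfin, ← I.sum_one z]
    exact Finset.sum_congr rfl hX0
  have hm0 : MeasurableSet {ω | π (X 0 ω) = z} := by
    rw [hset]
    exact Finset.measurableSet_biUnion _ fun x _ => hmeas 0 x
  have hae : ∀ᵐ ω ∂μ, π (X 0 ω) = z := by
    rw [Measure.real, ENNReal.toReal_eq_one_iff] at hstart
    exact (mem_ae_iff_prob_eq_one hm0).2 hstart
  have hlaw : ∀ t y, μ.real {ω | X t ω = y} = averaged fib κ P t z y := by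
    intro t y
    have h1 : μ.real {ω | X t ω = y} = μ.real (⋃ x ∈ fib z, {ω | X 0 ω = x ∧ X t ω = y}) := by
      refine measureReal_congr ?_
      filter_upwards [hae] with ω hω
      simp only [eq_iff_iff]
      change X t ω = y ↔ ω ∈ ⋃ x ∈ fib z, {ω | X 0 ω = x ∧ X t ω = y}
      simp [I.mem_fib, hω]
    rw [h1, measureReal_biUnion_finset, averaged]
    · refine Finset.sum_congr rfl fun x hx => ?_
      have h2 := hfd 1 ![0, t] ![x, y] (by
        intro i j hij
        fin_cases i <;> fin_cases j <;> simp at hij ⊢)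
      have e : {ω | ∀ i, X ((![0, t] : Fin 2 → ℝ≥0) i) ω = (![x, y] : Fin 2 → S) i} =
          {ω | X 0 ω = x ∧ X t ω = y} := by
        ext ω
        simp [Fin.forall_fin_two]
      rw [e] at h2
      simp only [Matrix.cons_val_zero, Matrix.cons_val_one, Finset.univ_unique, Finset.prod_singleton,
        Fin.default_eq_zero, Fin.castSucc_zero, Fin.succ_zero_eq_one, tsub_zero] at h2
      rw [h2, hX0 x hx]
    · intro x _ x' _ hxx
      exact Set.disjoint_left.2 fun ω h1 h2 => hxx (h1.1.symm.trans h2.1)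
    · intro x _
      exact (hmeas 0 x).inter (hmeas t y)
  intro m t s ht
  have h1 : {ω | ∀ i, π (X (t i) ω) = s i} =
      ⋃ x ∈ Fintype.piFinset (fun i => fib (s i)), {ω | ∀ i, X (t i) ω = x i} := by
    ext ω
    simp only [Set.mem_ofPred_eq, Set.mem_iUnion, Fintype.mem_piFinset, I.mem_fib, exists_prop]
    constructor
    · exact fun h => ⟨fun i => X (t i) ω, h, fun i => rfl⟩
    · rintro ⟨x, h2, h3⟩ i
      rw [h3, h2]
  rw [h1, measureReal_biUnion_finset]
  · rw [← I.sum_prod hP hQ m (fun i => t i.succ - t i.castSucc) s, Finset.mul_sum]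
    refine Finset.sum_congr rfl fun x hx => ?_
    have hx0 := (I.mem_fib _ _).1 (Fintype.mem_piFinset.1 hx 0)
    rw [hfd m t x ht, hlaw, I.averaged_eq hP hQ, hx0, hfin, projected, mul_assoc]
    simp only [hlaw]
  · intro x _ y _ hxy
    refine Set.disjoint_left.2 fun ω h1 h2 => hxy (funext fun i => (h1 i).symm.trans (h2 i))
  · intro x _
    have : {ω | ∀ i, X (t i) ω = x i} = ⋂ i, {ω | X (t i) ω = x i} := by ext; simp
    rw [this]
    exact MeasurableSet.iInter fun i => hmeas _ _

end Intertwining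

/-! ### Branching of alternants -/

theorem zpow_sub_mul_zpow_eq_sum {a b : ℝ} (ha : a ≠ 0) (hb : b ≠ 0) {p q : ℤ} (h : p ≤ q) :
    a ^ q - b ^ (q - p) * a ^ p = (a - b) * ∑ m ∈ Finset.Ico p q, b ^ (q - 1 - m) * a ^ m := by
  induction q, h using Int.leInduction with
  | base => simp
  | succ q hq ih =>
    have e : Finset.Ico p (q + 1) = insert q (Finset.Ico p q) := by
      ext m
      simp only [Finset.mem_insert, Finset.mem_Ico]
      omega
    have e2 : ∑ m ∈ Finset.Ico p q, b ^ (q + 1 - 1 - m) * a ^ m =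
        b * ∑ m ∈ Finset.Ico p q, b ^ (q - 1 - m) * a ^ m := by
      rw [Finset.mul_sum]
      refine Finset.sum_congr rfl fun m _ => ?_
      rw [← mul_assoc, ← zpow_one_add₀ hb]
      congr 2
      ring
    have e3 : b ^ (q + 1 - p) = b * b ^ (q - p) := by
      rw [← zpow_one_add₀ hb]
      congr 1
      ring
    rw [e, Finset.sum_insert (by simp), e2, e3, zpow_add_one₀ ha, mul_add, mul_left_comm (a - b) b,
      ← ih]
    simp
    ring

/-- The alternant `det (v_i ^ ℓ_j)`. -/
noncomputable def alternant {n : ℕ} (l : Fin n → ℤ) (v : Fin n → ℝ) : ℝ :=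
  (Matrix.of fun i j : Fin n => v i ^ l j).det

/-- Subtracting from each column the multiple of its predecessor that kills the last row leaves a
minor. Row `i` of this minor is divisible by `v_i - b`, and the quotients are geometric sums.
Multilinearity in the columns expands the determinant over the summation indices. -/
theorem alternant_succ {n : ℕ} (l : Fin (n + 1) → ℤ) (hl : Monotone l) (v : Fin (n + 1) → ℝ)
    (hv : ∀ i, v i ≠ 0) :
    alternant l v = (-1) ^ n * (∏ i : Fin n, (v i.castSucc - v (Fin.last n))) *
      ∑ m ∈ Fintype.piFinset fun j : Fin n => Finset.Ico (l j.castSucc) (l j.succ),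
        v (Fin.last n) ^ (∑ j, l j - n - ∑ j, m j) * alternant m fun i => v i.castSucc := by
  set b := v (Fin.last n) with hb
  have hb0 : b ≠ 0 := hv _
  set B : Matrix (Fin (n + 1)) (Fin (n + 1)) ℝ := Matrix.of fun i j =>
    Fin.cases (motive := fun _ => ℝ) (v i ^ l 0)
      (fun j => v i ^ l j.succ - b ^ (l j.succ - l j.castSucc) * v i ^ l j.castSucc) j with hB
  have h1 : alternant l v = B.det := by
    refine Matrix.det_eq_of_forall_col_eq_smul_add_pred
      (fun j => b ^ (l j.succ - l j.castSucc)) (fun i => rfl) (fun i j => ?_)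
    simp [hB]
  have hlast : ∀ j : Fin n, B (Fin.last n) j.succ = 0 := by
    intro j
    simp only [hB, Matrix.of_apply, Fin.cases_succ, ← hb]
    rw [← zpow_add₀ hb0]
    simp
  have h2 : B.det = (-1) ^ n * b ^ l 0 * (B.submatrix Fin.castSucc Fin.succ).det := by
    rw [Matrix.det_succ_row B (Fin.last n), Fin.sum_univ_succ]
    rw [Finset.sum_eq_zero fun j _ => by rw [hlast]; ring]
    simp only [Fin.val_last, Fin.val_zero, add_zero, Fin.succAbove_last, Fin.succAbove_zero]
    rfl
  have h3 : B.submatrix Fin.castSucc Fin.succ = Matrix.of fun i j : Fin n =>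
      (v i.castSucc - b) * (Matrix.of fun j i : Fin n =>
        ∑ m ∈ Finset.Ico (l j.castSucc) (l j.succ),
          b ^ (l j.succ - 1 - m) * v i.castSucc ^ m).transpose i j := by
    ext i j
    simp only [Matrix.submatrix_apply, hB, Matrix.of_apply, Fin.cases_succ, Matrix.transpose_apply]
    exact zpow_sub_mul_zpow_eq_sum (hv _) hb0 (hl (Fin.castSucc_lt_succ).le)
  have h4 : (Matrix.of fun j i : Fin n => ∑ m ∈ Finset.Ico (l j.castSucc) (l j.succ),
      b ^ (l j.succ - 1 - m) * v i.castSucc ^ m).det =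
      ∑ m ∈ Fintype.piFinset fun j : Fin n => Finset.Ico (l j.castSucc) (l j.succ),
        (∏ j, b ^ (l j.succ - 1 - m j)) * alternant m fun i => v i.castSucc := by
    have := (Matrix.detRowAlternating (n := Fin n) (R := ℝ)).toMultilinearMap.map_sum_finset
      (fun j (m : ℤ) => fun i : Fin n => b ^ (l j.succ - 1 - m) * v i.castSucc ^ m)
      (fun j => Finset.Ico (l j.castSucc) (l j.succ))
    have e : (Matrix.of fun j i : Fin n => ∑ m ∈ Finset.Ico (l j.castSucc) (l j.succ),
        b ^ (l j.succ - 1 - m) * v i.castSucc ^ m) =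
        fun j : Fin n => ∑ m ∈ Finset.Ico (l j.castSucc) (l j.succ),
          fun i : Fin n => b ^ (l j.succ - 1 - m) * v i.castSucc ^ m := by
      ext j i
      simp
    rw [e]
    refine this.trans (Finset.sum_congr rfl fun m _ => ?_)
    have := Matrix.det_mul_column (fun j => b ^ (l j.succ - 1 - m j))
      (Matrix.of fun i j : Fin n => v i.castSucc ^ m j).transpose
    rw [Matrix.det_transpose] at this
    exact this
  rw [h1, h2, h3, Matrix.det_mul_column, Matrix.det_transpose, h4, Finset.mul_sum, Finset.mul_sum,
    Finset.mul_sum]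
  refine Finset.sum_congr rfl fun m _ => ?_
  have h5 : b ^ (∑ j, l j - n - ∑ j, m j) = b ^ l 0 * ∏ j : Fin n, b ^ (l j.succ - 1 - m j) := by
    have h6 : ∀ s : Finset (Fin n), ∏ j ∈ s, b ^ (l j.succ - 1 - m j) =
        b ^ ∑ j ∈ s, (l j.succ - 1 - m j) := by
      intro s
      induction s using Finset.cons_induction with
      | empty => simp
      | cons a s ha ih => rw [Finset.prod_cons, Finset.sum_cons, ih, zpow_add₀ hb0]
    rw [h6, ← zpow_add₀ hb0]
    congr 1
    rw [Fin.sum_univ_succ]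
    simp only [Finset.sum_sub_distrib, Finset.sum_const, Finset.card_univ, Fintype.card_fin]
    simp
    ring
  rw [h5]
  ring

/-- The shift `m_j = y_j + j` turns half-open intervals into the interlacing condition, and the
difference of the two staircase sums cancels the `- n` in the exponent. -/
theorem alternant_add_succ {n : ℕ} (z : Fin (n + 1) → ℤ) (hz : Monotone z) (v : Fin (n + 1) → ℝ)
    (hv : ∀ i, v i ≠ 0) :
    alternant (fun j => z j + ((j : ℕ) : ℤ)) v =
      (-1) ^ n * (∏ i : Fin n, (v i.castSucc - v (Fin.last n))) *
      ∑ y ∈ Fintype.piFinset fun j : Fin n => Finset.Icc (z j.castSucc) (z j.succ),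
        v (Fin.last n) ^ (∑ j, z j - ∑ j, y j) *
          alternant (fun j => y j + ((j : ℕ) : ℤ)) fun i => v i.castSucc := by
  rw [alternant_succ _ (fun i j h => add_le_add (hz h) (by exact_mod_cast h)) v hv]
  congr 1
  refine Finset.sum_nbij' (fun m j => m j - ((j : ℕ) : ℤ)) (fun y j => y j + ((j : ℕ) : ℤ))
    ?_ ?_ ?_ ?_ ?_
  · intro m hm
    rw [Fintype.mem_piFinset] at hm ⊢
    intro j
    have := hm j
    simp only [Finset.mem_Ico, Finset.mem_Icc, Fin.val_castSucc, Fin.val_succ] at this ⊢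
    push_cast at this
    omega
  · intro y hy
    rw [Fintype.mem_piFinset] at hy ⊢
    intro j
    have := hy j
    simp only [Finset.mem_Ico, Finset.mem_Icc, Fin.val_castSucc, Fin.val_succ] at this ⊢
    push_cast
    omega
  · intro m _
    simp
  · intro m _
    simp
  · intro m _
    simp only [sub_add_cancel]
    congr 2
    rw [Finset.sum_add_distrib, Finset.sum_sub_distrib, Fin.sum_univ_castSucc (fun j =>
      (((j : Fin (n + 1)) : ℕ) : ℤ))]
    simp
    ring

theorem alternantQuotient_eq {n : ℕ} (x : Fin n → ℤ) (v : Fin n → ℝ) :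
    alternantQuotient x v = alternant (fun j => x j + ((j : ℕ) : ℤ)) v /
      alternant (fun j => ((j : ℕ) : ℤ)) v := by
  simp [alternantQuotient, alternant]

theorem alternant_ne_zero {n : ℕ} {v : Fin n → ℝ} (hv : Function.Injective v) :
    alternant (fun j => ((j : ℕ) : ℤ)) v ≠ 0 := by
  have := Matrix.det_vandermonde_ne_zero_iff.2 hv
  simpa [alternant, Matrix.vandermonde] using this

theorem alternantQuotient_succ {n : ℕ} (z : Fin (n + 1) → ℤ) (hz : Monotone z)
    (v : Fin (n + 1) → ℝ) (hv : ∀ i, v i ≠ 0) (hinj : Function.Injective v) :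
    alternantQuotient z v =
      ∑ y ∈ Fintype.piFinset fun j : Fin n => Finset.Icc (z j.castSucc) (z j.succ),
        v (Fin.last n) ^ (∑ j, z j - ∑ j, y j) * alternantQuotient y fun i => v i.castSucc := by
  have h1 := alternant_add_succ z hz v hv
  -- The denominator is the case `z = 0`, where only `y = 0` interlaces; it carries the same
  -- prefactor, which cancels.
  have h2 := alternant_add_succ 0 monotone_const v hv
  have e : (Fintype.piFinset fun j : Fin n =>
      Finset.Icc ((0 : Fin (n + 1) → ℤ) j.castSucc) ((0 : Fin (n + 1) → ℤ) j.succ)) = {0} := by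
    ext y
    simp [funext_iff]
  rw [e, Finset.sum_singleton] at h2
  simp only [Pi.zero_apply, zero_add, Finset.sum_const_zero, sub_self, zpow_zero, one_mul] at h2
  have h3 := alternant_ne_zero hinj
  have h4 : alternant (fun j => ((j : ℕ) : ℤ)) (fun i : Fin n => v i.castSucc) ≠ 0 :=
    alternant_ne_zero (hinj.comp (Fin.castSucc_injective n))
  rw [h2] at h3
  have h5 := left_ne_zero_of_mul h3
  simp only [alternantQuotient_eq]
  rw [h1, h2, mul_div_mul_left _ _ h5, Finset.sum_div]
  exact Finset.sum_congr rfl fun y _ => mul_div_assoc _ _ _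

/-! ### Patterns with a given bottom level -/

theorem IsGTPattern.bounds {n : ℕ} {x : GTIndex n → ℤ} (hx : IsGTPattern x) {a b : ℤ}
    (ha : ∀ i, a ≤ x (bottomIndex i)) (hb : ∀ i, x (bottomIndex i) ≤ b) (p : GTIndex n) :
    a ≤ x p ∧ x p ≤ b := by
  obtain ⟨k, hk⟩ : ∃ k, (p.1.1 : ℕ) + k + 1 = n := ⟨n - 1 - p.1.1, by have := p.1.1.2; omega⟩
  induction k generalizing p with
  | zero =>
    have : p = bottomIndex p.1.2 := by
      refine Subtype.ext (Prod.ext (Fin.ext ?_) rfl)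
      simp only [bottomIndex]
      omega
    rw [this]
    exact ⟨ha _, hb _⟩
  | succ k ih =>
    have hp : (p.1.2 : ℕ) ≤ p.1.1 := p.2
    let q : GTIndex n := ⟨(⟨p.1.1 + 1, by omega⟩, ⟨p.1.2, by omega⟩), by
      show (p.1.2 : ℕ) ≤ p.1.1 + 1
      omega⟩
    let r : GTIndex n := ⟨(⟨p.1.1 + 1, by omega⟩, ⟨p.1.2 + 1, by omega⟩), by
      show (p.1.2 : ℕ) + 1 ≤ p.1.1 + 1
      omega⟩
    have h1 := (hx p q).1 ⟨rfl, rfl⟩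
    have h2 := (hx p r).2 ⟨rfl, rfl⟩
    have h3 := ih q (by simp only [q]; omega)
    have h4 := ih r (by simp only [r]; omega)
    omega

theorem finite_setOf_bottom {n : ℕ} (y : Fin n → ℤ) :
    {x : GTPattern n | ∀ i, x.1 (bottomIndex i) = y i}.Finite := by
  obtain ⟨a, ha⟩ := (Set.finite_range y).bddBelow
  obtain ⟨b, hb⟩ := (Set.finite_range y).bddAbove
  refine Set.Finite.of_finite_image (f := Subtype.val) ?_ Subtype.val_injective.injOn
  refine (Set.Finite.pi' (fun _ : GTIndex n => Set.finite_Icc a b)).subset ?_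
  rintro _ ⟨x, hx, rfl⟩ p
  refine x.2.bounds (fun i => ?_) (fun i => ?_) p
  · rw [hx]; exact ha ⟨i, rfl⟩
  · rw [hx]; exact hb ⟨i, rfl⟩

/-- The finite set of patterns with bottom level `y`. -/
noncomputable def patternsWithBottom {n : ℕ} (y : Fin n → ℤ) : Finset (GTPattern n) :=
  (finite_setOf_bottom y).toFinset

theorem mem_patternsWithBottom {n : ℕ} {y : Fin n → ℤ} {x : GTPattern n} :
    x ∈ patternsWithBottom y ↔ ∀ i, x.1 (bottomIndex i) = y i := by
  simp [patternsWithBottom]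

theorem mem_patternsWithBottom_iff_bottom {n : ℕ} (z : WeylChamber n) (x : GTPattern n) :
    x ∈ patternsWithBottom z.1 ↔ x.bottom = z := by
  rw [mem_patternsWithBottom]
  constructor
  · exact fun h => Subtype.ext (funext h)
  · rintro rfl i; rfl

/-- The label of the same particle in an array with one more level. -/
def GTIndex.castSucc {n : ℕ} (p : GTIndex n) : GTIndex (n + 1) :=
  ⟨(p.1.1.castSucc, p.1.2.castSucc), p.2⟩

/-- The pattern without its bottom level. -/
def GTPattern.truncate {n : ℕ} (x : GTPattern (n + 1)) : GTPattern n :=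
  ⟨fun p => x.1 p.castSucc, fun p q => x.2 p.castSucc q.castSucc⟩

theorem GTIndex.castSucc_or_bottom {n : ℕ} (p : GTIndex (n + 1)) :
    (∃ q : GTIndex n, p = q.castSucc) ∨ ∃ i, p = bottomIndex i := by
  have h1 := p.1.1.2
  have h2 : (p.1.2 : ℕ) ≤ p.1.1 := p.2
  by_cases h : (p.1.1 : ℕ) < n
  · exact Or.inl ⟨⟨(⟨p.1.1, h⟩, ⟨p.1.2, by omega⟩), h2⟩, rfl⟩
  · refine Or.inr ⟨p.1.2, Subtype.ext (Prod.ext (Fin.ext ?_) rfl)⟩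
    simp only [bottomIndex]
    omega

/-- The pattern with a bottom level added. -/
def GTPattern.extend {n : ℕ} (x : GTPattern n) (z : Fin (n + 1) → ℤ)
    (h : ∀ i : Fin n, z i.castSucc ≤ x.1 (bottomIndex i) ∧ x.1 (bottomIndex i) ≤ z i.succ) :
    GTPattern (n + 1) :=
  ⟨fun p => if hp : (p.1.1 : ℕ) < n then
      x.1 ⟨(⟨p.1.1, hp⟩, ⟨p.1.2, lt_of_le_of_lt (show (p.1.2 : ℕ) ≤ p.1.1 from p.2) hp⟩), p.2⟩
    else z p.1.2, by
    intro p q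
    have hp2 : (p.1.2 : ℕ) ≤ p.1.1 := p.2
    have hq := q.1.1.2
    refine ⟨fun hpq => ?_, fun hpq => ?_⟩
    · obtain ⟨h1, h2⟩ := hpq
      have hp : (p.1.1 : ℕ) < n := by omega
      simp only [dif_pos hp]
      split_ifs with hq'
      · exact (x.2 _ _).1 ⟨h1, h2⟩
      · have := (h ⟨p.1.2, by omega⟩).1
        convert this using 2
        · exact Fin.ext h2
        · refine Subtype.ext (Prod.ext (Fin.ext ?_) rfl)
          simp only [bottomIndex]
          omega
    · obtain ⟨h1, h2⟩ := hpq
      have hp : (p.1.1 : ℕ) < n := by omega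
      simp only [dif_pos hp]
      split_ifs with hq'
      · exact (x.2 _ _).2 ⟨h1, h2⟩
      · have := (h ⟨p.1.2, by omega⟩).2
        convert this using 2
        · refine Subtype.ext (Prod.ext (Fin.ext ?_) rfl)
          simp only [bottomIndex]
          omega
        · exact Fin.ext h2⟩

/-- A pattern with bottom row `z` amounts to a row interlacing with `z` and a pattern ending in that
row. -/
theorem sum_patternsWithBottom_succ {n : ℕ} (z : Fin (n + 1) → ℤ) (f : GTPattern n → ℝ) :
    ∑ x ∈ patternsWithBottom z, f x.truncate =
      ∑ y ∈ Fintype.piFinset fun j : Fin n => Finset.Icc (z j.castSucc) (z j.succ),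
        ∑ x ∈ patternsWithBottom y, f x := by
  classical
  have hb : ∀ i : Fin n, ((bottomIndex i).castSucc.Below (bottomIndex i.castSucc) ∧
      (bottomIndex i).castSucc.BelowNext (bottomIndex i.succ)) := by
    intro i
    have := i.2
    refine ⟨⟨?_, ?_⟩, ⟨?_, ?_⟩⟩ <;> simp [bottomIndex, GTIndex.castSucc] <;> omega
  rw [← Finset.sum_fiberwise_of_maps_to (s := patternsWithBottom z)
    (g := fun x : GTPattern (n + 1) => fun i : Fin n => x.1 (bottomIndex i).castSucc)]
  · refine Finset.sum_congr rfl fun y hy => ?_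
    rw [Fintype.mem_piFinset] at hy
    refine Finset.sum_bij (fun x _ => x.truncate) ?_ ?_ ?_ ?_
    · intro x hx
      rw [Finset.mem_filter] at hx
      exact mem_patternsWithBottom.2 fun i => congrFun hx.2 i
    · intro x hx x' hx' h
      rw [Finset.mem_filter, mem_patternsWithBottom] at hx hx'
      refine Subtype.ext (funext fun p => ?_)
      rcases p.castSucc_or_bottom with ⟨q, rfl⟩ | ⟨i, rfl⟩
      · exact congrFun (congrArg Subtype.val h) q
      · rw [hx.1, hx'.1]
    · intro x hx
      rw [mem_patternsWithBottom] at hx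
      have h : ∀ i : Fin n, z i.castSucc ≤ x.1 (bottomIndex i) ∧
          x.1 (bottomIndex i) ≤ z i.succ := fun i => by
        rw [hx]; exact Finset.mem_Icc.1 (hy i)
      have ht : (x.extend z h).truncate = x := by
        refine Subtype.ext (funext fun p => ?_)
        exact dif_pos p.1.1.2
      refine ⟨x.extend z h, ?_, ht⟩
      rw [Finset.mem_filter, mem_patternsWithBottom]
      refine ⟨fun i => dif_neg (by simp [bottomIndex]), funext fun i => ?_⟩
      rw [← hx i]
      exact congrFun (congrArg Subtype.val ht) (bottomIndex i)
    · intro x _; rfl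
  · intro x hx
    rw [mem_patternsWithBottom] at hx
    refine Fintype.mem_piFinset.2 fun i => Finset.mem_Icc.2 ⟨?_, ?_⟩
    · rw [← hx]; exact (x.2 _ _).1 (hb i).1
    · rw [← hx]; exact (x.2 _ _).2 (hb i).2

theorem levelSum_self {n : ℕ} (x : GTIndex n → ℤ) : levelSum x n = ∑ i, x (bottomIndex i) := by
  unfold levelSum
  refine Finset.sum_bij' (fun p _ => p.1.2) (fun i _ => bottomIndex i) ?_ ?_ ?_ ?_ ?_
  · simp
  · intro i _
    have := i.2
    simp [bottomIndex]
    omega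
  · intro p hp
    refine Subtype.ext (Prod.ext (Fin.ext ?_) rfl)
    simp at hp
    simp only [bottomIndex]
    omega
  · intro i _; rfl
  · intro p hp
    congr 1
    refine Subtype.ext (Prod.ext (Fin.ext ?_) rfl)
    simp at hp
    simp only [bottomIndex]
    omega

theorem levelSum_truncate {n : ℕ} (x : GTPattern (n + 1)) {k : ℕ} (hk : k ≤ n) :
    levelSum x.truncate.1 k = levelSum x.1 k := by
  unfold levelSum
  refine Finset.sum_bij (fun p _ => p.castSucc) ?_ ?_ ?_ ?_
  · intro p hp
    simpa [GTIndex.castSucc] using hp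
  · intro p _ q _ h
    have h1 := congrArg (fun r : GTIndex (n + 1) => (r.1.1 : ℕ)) h
    have h2 := congrArg (fun r : GTIndex (n + 1) => (r.1.2 : ℕ)) h
    exact Subtype.ext (Prod.ext (Fin.ext h1) (Fin.ext h2))
  · intro p hp
    rcases p.castSucc_or_bottom with ⟨q, rfl⟩ | ⟨i, rfl⟩
    · exact ⟨q, by simpa [GTIndex.castSucc] using hp, rfl⟩
    · simp [bottomIndex] at hp
      omega
  · intro p _; rfl

theorem weight_succ {n : ℕ} (v : Fin (n + 1) → ℝ) {z : Fin (n + 1) → ℤ} {x : GTPattern (n + 1)}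
    (hx : x ∈ patternsWithBottom z) :
    weight v x = weight (fun i => v i.castSucc) x.truncate *
      v (Fin.last n) ^ (∑ j, z j - ∑ j, x.truncate.1 (bottomIndex j)) := by
  rw [mem_patternsWithBottom] at hx
  unfold weight
  rw [Fin.prod_univ_castSucc]
  congr 1
  · refine Finset.prod_congr rfl fun i _ => ?_
    have := i.2
    rw [levelSum_truncate x (by omega), levelSum_truncate x (by omega)]
    rfl
  · rw [← levelSum_self, levelSum_truncate x le_rfl]
    simp only [Fin.val_last]
    rw [levelSum_self]
    simp [hx]

theorem alternantQuotient_eq_sum_weight {n : ℕ} (z : Fin n → ℤ) (hz : Monotone z) (v : Fin n → ℝ)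
    (hv : ∀ i, v i ≠ 0) (hinj : Function.Injective v) :
    alternantQuotient z v = ∑ x ∈ patternsWithBottom z, weight v x := by
  induction n with
  | zero =>
    let x₀ : GTPattern 0 := ⟨fun p => p.1.1.elim0, fun p => p.1.1.elim0⟩
    have h : patternsWithBottom z = {x₀} := by
      ext x
      rw [mem_patternsWithBottom, Finset.mem_singleton]
      exact ⟨fun _ => Subtype.ext (funext fun p => p.1.1.elim0), fun _ i => i.elim0⟩
    rw [h]
    simp [alternantQuotient, weight]
  | succ n ih =>
    rw [alternantQuotient_succ z hz v hv hinj,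
      Finset.sum_congr rfl fun x hx => weight_succ v hx,
      sum_patternsWithBottom_succ z (fun x => weight (fun i => v i.castSucc) x *
        v (Fin.last n) ^ (∑ j, z j - ∑ j, x.1 (bottomIndex j)))]
    refine Finset.sum_congr rfl fun y hy => ?_
    rw [Fintype.mem_piFinset] at hy
    -- Interlacing yields `y i ≤ z (i + 1) ≤ z j ≤ y j` for `i < j`, so the induction hypothesis
    -- applies to `y`.
    have hmono : Monotone y := by
      intro i j hij
      rcases hij.eq_or_lt with rfl | h
      · exact le_rfl
      · have h1 := Finset.mem_Icc.1 (hy i)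
        have h2 := Finset.mem_Icc.1 (hy j)
        have h3 : z i.succ ≤ z j.castSucc := hz (by
          rw [Fin.le_def]
          simpa using h)
        omega
    rw [ih y hmono (fun i => v i.castSucc) (fun i => hv _) (hinj.comp (Fin.castSucc_injective n)),
      Finset.mul_sum]
    refine Finset.sum_congr rfl fun x hx => ?_
    rw [mem_patternsWithBottom] at hx
    simp only [hx]
    ring

/-- Density makes the filter in the definition of `schur` nontrivial at every `v`, so that the limit
is unique. -/
theorem dense_setOf_injective (n : ℕ) : Dense {u : Fin n → ℝ | Function.Injective u} := by
  have h : {u : Fin n → ℝ | Function.Injective u} =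
      ⋂ p : {p : Fin n × Fin n // p.1 ≠ p.2}, {u | u p.1.1 ≠ u p.1.2} := by
    ext u
    simp only [Set.mem_ofPred_eq, Set.mem_iInter, Subtype.forall, Prod.forall]
    exact ⟨fun h a b hab e => hab (h e), fun h a b e => by_contra fun hab => h a b hab e⟩
  rw [h]
  refine dense_iInter_of_isOpen (fun p => ?_) (fun p => ?_)
  · exact isOpen_ne_fun (continuous_apply _) (continuous_apply _)
  · obtain ⟨⟨a, b⟩, hab⟩ := p
    rw [Metric.dense_iff]
    intro u r hr
    by_cases hu : u a = u b
    · refine ⟨Function.update u a (u a + r / 2), ?_, ?_⟩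
      · rw [Metric.mem_ball, dist_pi_lt_iff hr]
        intro i
        by_cases hi : i = a
        · subst hi
          simp [abs_of_pos hr]
          linarith
        · simp [hi, hr]
      · have hba : b ≠ a := fun h => hab h.symm
        simp [hba, hu]
        exact hr.ne'
    · exact ⟨u, Metric.mem_ball_self hr, hu⟩

/-- The combinatorial formula for the Schur function. -/
theorem schur_eq_sum_weight {n : ℕ} (z : WeylChamber n) (v : Fin n → ℝ) (hv : ∀ i, 0 < v i) :
    schur z.1 v = ∑ x ∈ patternsWithBottom z.1, weight v x := by
  have : (𝓝[{u : Fin n → ℝ | Function.Injective u}] v).NeBot :=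
    mem_closure_iff_nhdsWithin_neBot.1 (dense_setOf_injective n v)
  refine Tendsto.limUnder_eq ?_
  have hc : ContinuousAt (fun u : Fin n → ℝ => ∑ x ∈ patternsWithBottom z.1, weight u x) v := by
    refine tendsto_finsetSum _ fun x _ => tendsto_finsetProd _ fun i _ => ?_
    exact (continuous_apply i).continuousAt.zpow₀ _ (Or.inl (hv i).ne')
  refine (hc.tendsto.mono_left nhdsWithin_le_nhds).congr' ?_
  have hpos : ∀ᶠ u in 𝓝 v, ∀ i, u i ≠ 0 := by
    rw [eventually_all]
    exact fun i => (continuous_apply i).continuousAt.eventually_ne (hv i).ne'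
  filter_upwards [self_mem_nhdsWithin, nhdsWithin_le_nhds hpos] with u hu hu0
  exact (alternantQuotient_eq_sum_weight z.1 z.2 u hu0 hu).symm

theorem weight_pos {n : ℕ} {v : Fin n → ℝ} (hv : ∀ i, 0 < v i) (x : GTPattern n) :
    0 < weight v x :=
  Finset.prod_pos fun i _ => zpow_pos (hv i) _

theorem schur_pos {n : ℕ} (z : WeylChamber n) (v : Fin n → ℝ) (hv : ∀ i, 0 < v i) :
    0 < schur z.1 v := by
  rw [schur_eq_sum_weight z v hv]
  refine Finset.sum_pos (fun x _ => weight_pos hv x) ?_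
  -- The fibre is nonempty: take `x^j_i = z_i` on every level.
  refine ⟨⟨fun p => z.1 p.1.2, fun p q => ⟨fun h => ?_, fun h => ?_⟩⟩, ?_⟩
  · exact le_of_eq (congrArg z.1 (Fin.ext h.2))
  · exact z.2 (by rw [Fin.le_def, h.2]; omega)
  · exact mem_patternsWithBottom.2 fun i => rfl

/-! ### Diagonals -/

/-- Two particles on the same diagonal `x^j_i, x^{j+1}_{i+1}, …`. -/
def GTIndex.SameDiag {n : ℕ} (p q : GTIndex n) : Prop :=
  (p.1.1 : ℕ) + q.1.2 = q.1.1 + p.1.2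

theorem GTIndex.ext_of_val {n : ℕ} {p q : GTIndex n} (h1 : (p.1.1 : ℕ) = q.1.1)
    (h2 : (p.1.2 : ℕ) = q.1.2) : p = q :=
  Subtype.ext (Prod.ext (Fin.ext h1) (Fin.ext h2))

theorem IsGTPattern.le_of_sameDiag {n : ℕ} {x : GTIndex n → ℤ} (hx : IsGTPattern x)
    {p q : GTIndex n} (h : p.SameDiag q) (hpq : (p.1.1 : ℕ) ≤ q.1.1) : x p ≤ x q := by
  obtain ⟨k, hk⟩ := Nat.exists_eq_add_of_le hpq
  unfold GTIndex.SameDiag at h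
  induction k generalizing q with
  | zero =>
    rw [GTIndex.ext_of_val (p := p) (q := q) (by omega) (by omega)]
  | succ k ih =>
    have hq := q.1.1.2
    have hp2 : (p.1.2 : ℕ) ≤ p.1.1 := p.2
    let r : GTIndex n := ⟨(⟨q.1.1 - 1, by omega⟩, ⟨q.1.2 - 1, by omega⟩), by
      show (q.1.2 : ℕ) - 1 ≤ q.1.1 - 1
      omega⟩
    have h1 : x p ≤ x r := ih (by simp only [r]; omega) (by simp only [r]; omega)
      (by simp only [r]; omega)
    exact h1.trans ((hx r q).2 ⟨by simp only [r]; omega, by simp only [r]; omega⟩)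

/-- Positions increase weakly down a diagonal, so equality with the position of `p` forces equality
with every particle in between, and the push propagates. -/
theorem movesRight_iff {n : ℕ} {x : GTIndex n → ℤ} (hx : IsGTPattern x) {p q : GTIndex n} :
    MovesRight x p q ↔ p.SameDiag q ∧ (p.1.1 : ℕ) ≤ q.1.1 ∧ x q = x p := by
  constructor
  · intro h
    induction h with
    | self => exact ⟨by simp [GTIndex.SameDiag], le_rfl, rfl⟩
    | push q r _ hqr he ih =>
      obtain ⟨h1, h2⟩ := hqr
      obtain ⟨h3, h4, h5⟩ := ih
      unfold GTIndex.SameDiag at *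
      exact ⟨by omega, by omega, by omega⟩
  · rintro ⟨h, hpq, he⟩
    obtain ⟨k, hk⟩ := Nat.exists_eq_add_of_le hpq
    unfold GTIndex.SameDiag at h
    induction k generalizing q with
    | zero =>
      rw [GTIndex.ext_of_val (p := q) (q := p) (by omega) (by omega)]
      exact .self
    | succ k ih =>
      have hq := q.1.1.2
      have hp2 : (p.1.2 : ℕ) ≤ p.1.1 := p.2
      let r : GTIndex n := ⟨(⟨q.1.1 - 1, by omega⟩, ⟨q.1.2 - 1, by omega⟩), by
        show (q.1.2 : ℕ) - 1 ≤ q.1.1 - 1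
        omega⟩
      have h1 : x p ≤ x r := hx.le_of_sameDiag
        (by simp only [GTIndex.SameDiag, r]; omega) (by simp only [r]; omega)
      have hrq : r.BelowNext q := ⟨by simp only [r]; omega, by simp only [r]; omega⟩
      have h2 := (hx r q).2 hrq
      have e1 : (r.1.1 : ℕ) = q.1.1 - 1 := rfl
      have e2 : (r.1.2 : ℕ) = q.1.2 - 1 := rfl
      exact .push r q (ih (by omega) (by omega) (by omega) (by omega)) hrq (by omega)

/-! ### Inverting a right jump -/

/-- The particles that moved in a right jump whose last moving particle is `q`, in terms of the
array `y` after the jump. -/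
def MovedWith {n : ℕ} (y : GTIndex n → ℤ) (q r : GTIndex n) : Prop :=
  r.SameDiag q ∧ (r.1.1 : ℕ) ≤ q.1.1 ∧ y r = y q

open Classical in
/-- The array before a right jump that ended at the particle `q`. -/
noncomputable def lowerArray {n : ℕ} (y : GTIndex n → ℤ) (q : GTIndex n) : GTIndex n → ℤ :=
  fun r => if MovedWith y q r then y r - 1 else y r

/-- `p` is the first particle that moved in a right jump that ended at the particle `q`. -/
def IsStart {n : ℕ} (y : GTIndex n → ℤ) (q p : GTIndex n) : Prop :=
  MovedWith y q p ∧ ∀ r, MovedWith y q r → (p.1.1 : ℕ) ≤ r.1.1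

theorem movedWith_self {n : ℕ} (y : GTIndex n → ℤ) (q : GTIndex n) : MovedWith y q q :=
  ⟨rfl, le_rfl, rfl⟩

theorem exists_isStart {n : ℕ} (y : GTIndex n → ℤ) (q : GTIndex n) : ∃ p, IsStart y q p := by
  classical
  obtain ⟨p, hp, hmin⟩ := Finset.exists_min_image (Finset.univ.filter (MovedWith y q))
    (fun r => (r.1.1 : ℕ)) ⟨q, by simpa using movedWith_self y q⟩
  exact ⟨p, by simpa using hp, fun r hr => hmin r (by simpa using hr)⟩

theorem IsStart.unique {n : ℕ} {y : GTIndex n → ℤ} {q p p' : GTIndex n} (h : IsStart y q p)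
    (h' : IsStart y q p') : p = p' := by
  have h1 := h.2 p' h'.1
  have h2 := h'.2 p h.1
  obtain ⟨h3, -, -⟩ := h.1
  obtain ⟨h4, -, -⟩ := h'.1
  unfold GTIndex.SameDiag at h3 h4
  exact GTIndex.ext_of_val (by omega) (by omega)

theorem IsStart.movedWith_iff {n : ℕ} {y : GTIndex n → ℤ} (hy : IsGTPattern y) {q p : GTIndex n}
    (h : IsStart y q p) (r : GTIndex n) :
    MovedWith y q r ↔ r.SameDiag q ∧ (p.1.1 : ℕ) ≤ r.1.1 ∧ (r.1.1 : ℕ) ≤ q.1.1 := by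
  constructor
  · exact fun hr => ⟨hr.1, h.2 r hr, hr.2.1⟩
  · rintro ⟨h1, h2, h3⟩
    refine ⟨h1, h3, le_antisymm (hy.le_of_sameDiag h1 h3) ?_⟩
    rw [← h.1.2.2]
    refine hy.le_of_sameDiag ?_ h2
    have := h.1.1
    unfold GTIndex.SameDiag at *
    omega

/-- Take `q` to be the lowest particle moved. After the jump, any unmoved particle above it on the
diagonal is strictly to its left, so `y` and `q` together determine the moved particles. -/
theorem exists_end_of_rightArray {n : ℕ} {x : GTIndex n → ℤ} (hx : IsGTPattern x) {p : GTIndex n}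
    (hp : ¬ BlockedRight x p) :
    ∃ q, lowerArray (rightArray x p) q = x ∧ IsStart (rightArray x p) q p := by
  classical
  obtain ⟨q, hq, hmax⟩ := Finset.exists_max_image (Finset.univ.filter (MovesRight x p))
    (fun r => (r.1.1 : ℕ)) ⟨p, by simpa using MovesRight.self⟩
  simp only [Finset.mem_filter, Finset.mem_univ, true_and] at hq hmax
  have hy : ∀ r, rightArray x p r = if MovesRight x p r then x r + 1 else x r := fun r => by
    rw [rightArray, if_neg hp]
  have hq' := (movesRight_iff hx).1 hq
  have key : ∀ r, MovedWith (rightArray x p) q r ↔ MovesRight x p r := by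
    intro r
    unfold MovedWith
    rw [hy r, hy q, if_pos hq]
    constructor
    · rintro ⟨h1, h2, h3⟩
      by_contra hr
      rw [if_neg hr] at h3
      have := hx.le_of_sameDiag h1 h2
      omega
    · intro hr
      have hr' := (movesRight_iff hx).1 hr
      rw [if_pos hr]
      refine ⟨?_, hmax r hr, by rw [hr'.2.2, hq'.2.2]⟩
      have h1 := hr'.1
      have h2 := hq'.1
      unfold GTIndex.SameDiag at *
      omega
  refine ⟨q, funext fun r => ?_, (key p).2 .self, fun r hr => ?_⟩
  · rw [lowerArray, hy r]
    simp only [key]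
    split_ifs <;> omega
  · exact ((movesRight_iff hx).1 ((key r).1 hr)).2.1

theorem rightArray_lowerArray {n : ℕ} {y : GTIndex n → ℤ} (hy : IsGTPattern y) {q p : GTIndex n}
    (hx : IsGTPattern (lowerArray y q)) (hp : IsStart y q p) :
    ¬ BlockedRight (lowerArray y q) p ∧ rightArray (lowerArray y q) p = y := by
  classical
  have hpx : lowerArray y q p = y p - 1 := if_pos hp.1
  have hb : ¬ BlockedRight (lowerArray y q) p := by
    rintro ⟨b, hb, he⟩
    -- The particle `b` lies on another diagonal and keeps its position, while `p` is lowered from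
    -- at most that position; hence `p` is strictly left of `b`.
    have h1 := (hy b p).1 hb
    have h2 : ¬ MovedWith y q b := fun h => by
      have h3 := h.1
      have h4 := hp.1.1
      obtain ⟨h5, h6⟩ := hb
      unfold GTIndex.SameDiag at *
      omega
    rw [hpx, lowerArray, if_neg h2] at he
    omega
  refine ⟨hb, funext fun r => ?_⟩
  have key : MovesRight (lowerArray y q) p r ↔ MovedWith y q r := by
    rw [movesRight_iff hx, hpx]
    constructor
    · rintro ⟨h1, h2, h3⟩
      by_contra hr
      rw [lowerArray, if_neg hr] at h3
      have := hy.le_of_sameDiag h1 h2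
      omega
    · intro hr
      refine ⟨?_, hp.2 r hr, ?_⟩
      · have h3 := hr.1
        have h4 := hp.1.1
        unfold GTIndex.SameDiag at *
        omega
      · rw [lowerArray, if_pos hr, hr.2.2, hp.1.2.2]
  rw [rightArray, if_neg hb]
  simp only [key]
  rw [lowerArray]
  split_ifs <;> omega

theorem levelSum_lowerArray {n : ℕ} {y : GTIndex n → ℤ} (hy : IsGTPattern y) {q p : GTIndex n}
    (hp : IsStart y q p) (k : ℕ) :
    levelSum (lowerArray y q) k =
      levelSum y k - if (p.1.1 : ℕ) + 1 ≤ k ∧ k ≤ q.1.1 + 1 then 1 else 0 := by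
  classical
  have h1 : ∀ r, lowerArray y q r = y r - if MovedWith y q r then 1 else 0 := fun r => by
    rw [lowerArray]
    split_ifs <;> omega
  unfold levelSum
  simp only [h1]
  rw [Finset.sum_sub_distrib]
  congr 1
  simp only [hp.movedWith_iff hy]
  have hpq := hp.1.2.1
  have hd := hp.1.1
  have hp2 : (p.1.2 : ℕ) ≤ p.1.1 := p.2
  have hq := q.1.1.2
  unfold GTIndex.SameDiag at *
  split_ifs with hk
  · let r : GTIndex n := ⟨(⟨k - 1, by omega⟩, ⟨k - 1 - (p.1.1 - p.1.2), by omega⟩), by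
      show k - 1 - (p.1.1 - p.1.2) ≤ k - 1
      omega⟩
    rw [Finset.sum_eq_single r]
    · rw [if_pos]
      simp only [r]
      omega
    · intro s hs hsr
      rw [Finset.mem_filter] at hs
      rw [if_neg]
      rintro ⟨h2, h3, h4⟩
      refine hsr (GTIndex.ext_of_val ?_ ?_) <;> simp only [r] <;> omega
    · intro hr
      exact absurd (Finset.mem_filter.2 ⟨Finset.mem_univ _, by simp only [r]; omega⟩) hr
  · refine Finset.sum_eq_zero fun s hs => if_neg ?_
    rw [Finset.mem_filter] at hs
    omega

/-- The rate of the particles on the level after that of `q`, and `1` if there is no such level. -/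
noncomputable def nextRate {n : ℕ} (v : Fin n → ℝ) (q : GTIndex n) : ℝ :=
  ∏ i : Fin n, if (i : ℕ) = q.1.1 + 1 then v i else 1

theorem nextRate_eq {n : ℕ} (v : Fin n → ℝ) {q p : GTIndex n} (h : (p.1.1 : ℕ) = q.1.1 + 1) :
    nextRate v q = v p.1.1 := by
  unfold nextRate
  rw [Finset.prod_eq_single p.1.1, if_pos h]
  · intro i _ hi
    refine if_neg fun h' => hi (Fin.ext ?_)
    omega
  · simp

theorem nextRate_eq_one {n : ℕ} (v : Fin n → ℝ) {q : GTIndex n} (h : (q.1.1 : ℕ) + 1 = n) :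
    nextRate v q = 1 := by
  refine Finset.prod_eq_one fun i _ => if_neg ?_
  have := i.2
  omega

/-- Lowering one particle on each level from that of `p` to that of `q` changes only two consecutive
differences of level sums: at the level of `p`, and at the level just after `q` if there is one. -/
theorem weight_lower_mul {n : ℕ} {v : Fin n → ℝ} (hv : ∀ i, 0 < v i) {x y : GTPattern n}
    {q p : GTIndex n} (hx : lowerArray y.1 q = x.1) (hp : IsStart y.1 q p) :
    weight v x * v p.1.1 = weight v y * nextRate v q := by
  have e : v p.1.1 = ∏ i : Fin n, if i = p.1.1 then v i else 1 := by simp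
  rw [e]
  unfold weight nextRate
  rw [← Finset.prod_mul_distrib, ← Finset.prod_mul_distrib]
  refine Finset.prod_congr rfl fun i _ => ?_
  have h0 : v i ≠ 0 := (hv i).ne'
  have h1 : ∀ c : Prop, [Decidable c] → (if c then v i else 1) = v i ^ (if c then 1 else 0 : ℤ) := by
    intro c _
    split_ifs <;> simp
  rw [h1, h1, ← zpow_add₀ h0, ← zpow_add₀ h0, ← hx, levelSum_lowerArray y.2 hp,
    levelSum_lowerArray y.2 hp]
  congr 1
  have hpq := hp.1.2.1
  have h2 : i = p.1.1 ↔ (i : ℕ) = p.1.1 := Fin.ext_iff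
  simp only [h2]
  split_ifs <;> omega

/-- Lowering can only violate the inequality between a moved particle and the one below it with the
same index. For `q` this is `h2`. Higher up, that lower particle lies on the adjacent diagonal and
is bounded by the left neighbour of `q`, so `h1` suffices. -/
theorem isGTPattern_lowerArray {n : ℕ} {y : GTIndex n → ℤ} (hy : IsGTPattern y) {q : GTIndex n}
    (h1 : ∀ r : GTIndex n, (r.1.1 : ℕ) = q.1.1 → (r.1.2 : ℕ) + 1 = q.1.2 → y r < y q)
    (h2 : ∀ r, q.Below r → y r < y q) : IsGTPattern (lowerArray y q) := by
  classical
  intro s t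
  unfold lowerArray
  refine ⟨fun hst => ?_, fun hst => ?_⟩
  · have h3 := (hy s t).1 hst
    by_cases hs : MovedWith y q s
    · have h4 : y t < y s := by
        obtain ⟨hd, hl, he⟩ := hs
        rw [he]
        obtain ⟨e1, e2⟩ := hst
        have hq := q.1.2.2
        have hs2 : (s.1.2 : ℕ) ≤ s.1.1 := s.2
        have hq2 : (q.1.2 : ℕ) ≤ q.1.1 := q.2
        unfold GTIndex.SameDiag at hd
        rcases hl.eq_or_lt with hl | hl
        · exact h2 t ⟨by omega, by omega⟩
        · let r : GTIndex n := ⟨(q.1.1, ⟨q.1.2 - 1, by omega⟩), by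
            show (q.1.2 : ℕ) - 1 ≤ q.1.1
            omega⟩
          refine (hy.le_of_sameDiag (q := r) ?_ ?_).trans_lt (h1 r rfl ?_)
          · simp only [GTIndex.SameDiag, r]; omega
          · simp only [r]; omega
          · simp only [r]; omega
      split_ifs <;> omega
    · split_ifs <;> omega
  · have h3 := (hy s t).2 hst
    by_cases ht : MovedWith y q t
    · have h4 : y s = y t → MovedWith y q s := by
        intro he
        obtain ⟨hd, hl, he'⟩ := ht
        obtain ⟨e1, e2⟩ := hst
        unfold GTIndex.SameDiag at hd
        exact ⟨by unfold GTIndex.SameDiag; omega, by omega, by omega⟩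
      by_cases hs : MovedWith y q s
      · simp only [if_pos hs, if_pos ht]; omega
      · have : y s ≠ y t := fun he => hs (h4 he)
        simp only [if_neg hs, if_pos ht]; omega
    · split_ifs <;> omega

theorem lt_of_isGTPattern_lowerArray {n : ℕ} {y : GTIndex n → ℤ} {q : GTIndex n}
    (hx : IsGTPattern (lowerArray y q)) {r : GTIndex n} (hr : q.Below r) : y r < y q := by
  classical
  have h1 := (hx q r).1 hr
  have h2 : ¬ MovedWith y q r := fun h => by
    have := h.2.1
    have := hr.1
    omega
  unfold lowerArray at h1
  rw [if_neg h2, if_pos (movedWith_self y q)] at h1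
  omega

theorem lowerArray_bottom {n : ℕ} (y : GTIndex n → ℤ) (q : GTIndex n) (i : Fin n) :
    lowerArray y q (bottomIndex i) =
      y (bottomIndex i) - if q = bottomIndex i then 1 else 0 := by
  classical
  have h : MovedWith y q (bottomIndex i) ↔ q = bottomIndex i := by
    constructor
    · rintro ⟨h1, h2, -⟩
      unfold GTIndex.SameDiag at h1
      have := q.1.1.2
      have h3 : ((bottomIndex i).1.1 : ℕ) = n - 1 := rfl
      exact GTIndex.ext_of_val (by omega) (by omega)
    · rintro rfl
      exact movedWith_self _ _
  unfold lowerArray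
  simp only [h]
  split_ifs <;> omega

/-! ### The balance of right jumps -/

open Classical in
-- Unblocked jumps into `y` correspond bijectively to their last moved particle `q`; the weight
-- ratio turns the starting rate into the rate of the level after `q`.
theorem sum_unblocked_right {n : ℕ} {v : Fin n → ℝ} (hv : ∀ i, 0 < v i) (z : Fin n → ℤ)
    (y : GTPattern n) :
    ∑ a ∈ (patternsWithBottom z ×ˢ Finset.univ).filter
        (fun a : GTPattern n × GTIndex n => ¬ BlockedRight a.1.1 a.2 ∧ y = a.1.ringRight a.2),
      weight v a.1 * v a.2.1.1 =
    weight v y * ∑ q : GTIndex n with ∃ x ∈ patternsWithBottom z, lowerArray y.1 q = x.1,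
      nextRate v q := by
  rw [Finset.mul_sum]
  have hex : ∀ a ∈ (patternsWithBottom z ×ˢ Finset.univ).filter
      (fun a : GTPattern n × GTIndex n => ¬ BlockedRight a.1.1 a.2 ∧ y = a.1.ringRight a.2),
      ∃ q, lowerArray y.1 q = a.1.1 ∧ IsStart y.1 q a.2 := by
    intro a ha
    obtain ⟨-, h1, h2⟩ := Finset.mem_filter.1 ha
    rw [h2]
    exact exists_end_of_rightArray a.1.2 h1
  choose f hf using hex
  refine Finset.sum_bij f ?_ ?_ ?_ ?_
  · intro a ha
    have h := Finset.mem_product.1 (Finset.mem_filter.1 ha).1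
    exact Finset.mem_filter.2 ⟨Finset.mem_univ _, a.1, h.1, (hf a ha).1⟩
  · intro a ha b hb hab
    obtain ⟨h1, h2⟩ := hf a ha
    obtain ⟨h3, h4⟩ := hf b hb
    rw [← hab] at h3 h4
    exact Prod.ext (Subtype.ext (h1.symm.trans h3)) (h2.unique h4)
  · intro q hq
    obtain ⟨-, x, hx, he⟩ := Finset.mem_filter.1 hq
    obtain ⟨p, hp⟩ := exists_isStart y.1 q
    obtain ⟨h1, h2⟩ := rightArray_lowerArray y.2 (he ▸ x.2) hp
    rw [he] at h1 h2
    have ha : (x, p) ∈ (patternsWithBottom z ×ˢ Finset.univ).filter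
        (fun a : GTPattern n × GTIndex n => ¬ BlockedRight a.1.1 a.2 ∧ y = a.1.ringRight a.2) :=
      Finset.mem_filter.2 ⟨Finset.mem_product.2 ⟨hx, Finset.mem_univ _⟩, h1, Subtype.ext h2.symm⟩
    refine ⟨(x, p), ha, ?_⟩
    obtain ⟨h3, h4⟩ := hf _ ha
    -- The lowered array determines the moved set, and its lowest element is the end particle; so
    -- the chosen end is `q`.
    have h5 : ∀ r, MovedWith y.1 (f _ ha) r ↔ MovedWith y.1 q r := by
      intro r
      have h6 : lowerArray y.1 (f _ ha) r = lowerArray y.1 q r := by rw [h3, he]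
      unfold lowerArray at h6
      split_ifs at h6 with h7 h8 h8
      · simp only [h7, h8]
      · omega
      · omega
      · simp only [h7, h8]
    have h7 := (h5 _).1 (movedWith_self y.1 _)
    have h8 := (h5 _).2 (movedWith_self y.1 _)
    have h9 := h7.1
    unfold GTIndex.SameDiag at h9
    have := h7.2.1
    have := h8.2.1
    exact GTIndex.ext_of_val (by omega) (by omega)
  · intro a ha
    obtain ⟨h1, h2⟩ := hf a ha
    exact weight_lower_mul hv h1 h2

open Classical in
theorem sum_ringRight_eq {n : ℕ} {v : Fin n → ℝ} (hv : ∀ i, 0 < v i) (z : Fin n → ℤ)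
    (y : GTPattern n) :
    ∑ x ∈ patternsWithBottom z, weight v x *
        ∑ p : GTIndex n, v p.1.1 * (if y = x.ringRight p then 1 else 0) =
      weight v y * ((if y ∈ patternsWithBottom z then
          ∑ p : GTIndex n with BlockedRight y.1 p, v p.1.1 else 0) +
        ∑ q : GTIndex n with ∃ x ∈ patternsWithBottom z, lowerArray y.1 q = x.1, nextRate v q) := by
  rw [mul_add, ← sum_unblocked_right hv,
    Finset.sum_filter (s := patternsWithBottom z ×ˢ Finset.univ), Finset.sum_product]
  have h1 : ∀ x : GTPattern n, ∀ p, BlockedRight x.1 p → x.ringRight p = x := fun x p hp =>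
    Subtype.ext (if_pos hp)
  have h2 : weight v y * (if y ∈ patternsWithBottom z then
      ∑ p : GTIndex n with BlockedRight y.1 p, v p.1.1 else 0) =
      ∑ x ∈ patternsWithBottom z, if y = x then
        weight v x * ∑ p : GTIndex n with BlockedRight x.1 p, v p.1.1 else 0 := by
    rw [Finset.sum_ite_eq, mul_ite, mul_zero]
  rw [h2, ← Finset.sum_add_distrib]
  refine Finset.sum_congr rfl fun x _ => ?_
  have h3 : (if y = x then weight v x * ∑ p : GTIndex n with BlockedRight x.1 p, v p.1.1 else 0) =
      ∑ p : GTIndex n, if y = x ∧ BlockedRight x.1 p then weight v x * v p.1.1 else 0 := by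
    split_ifs with h
    · simp only [h, true_and, Finset.mul_sum, Finset.sum_filter, mul_ite, mul_zero]
    · simp only [h, false_and, if_false, Finset.sum_const_zero]
  rw [h3, Finset.mul_sum, ← Finset.sum_add_distrib]
  refine Finset.sum_congr rfl fun p _ => ?_
  by_cases hb : BlockedRight x.1 p
  · rw [h1 x p hb]
    by_cases hy : y = x <;> simp [hb, hy]
  · by_cases hy : y = x.ringRight p <;> simp [hb, hy]

open Classical in
-- Each particle `p` with `i < j` has a particle `q` above it with the same index. Either `p` is
-- blocked by `q` and counts in the first sum, or `q` can be lowered and counts in the second with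
-- the rate of `p`. The total does not depend on `y`.
theorem sum_blocked_add_sum_nextRate {n : ℕ} (v : Fin n → ℝ) (y : GTPattern n) :
    ∑ p : GTIndex n with BlockedRight y.1 p, v p.1.1 +
      ∑ q : GTIndex n with ∃ x ∈ patternsWithBottom fun i => y.1 (bottomIndex i),
        lowerArray y.1 q = x.1, nextRate v q =
      ∑ p : GTIndex n with p.1.2 < p.1.1, v p.1.1 := by
  rw [← Finset.sum_filter_add_sum_filter_not (Finset.univ.filter fun p : GTIndex n => p.1.2 < p.1.1)
    (fun p => BlockedRight y.1 p), Finset.filter_filter, Finset.filter_filter]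
  have hab : ∀ p : GTIndex n, p.1.2 < p.1.1 → ∃ q : GTIndex n, q.Below p := by
    intro p hp
    have h1 := p.1.1.2
    have h2 : (p.1.2 : ℕ) < p.1.1 := hp
    refine ⟨⟨(⟨p.1.1 - 1, by omega⟩, p.1.2), ?_⟩, ?_, rfl⟩
    · show (p.1.2 : ℕ) ≤ p.1.1 - 1
      omega
    · simp only []
      omega
  congr 1
  · refine Finset.sum_congr (Finset.filter_congr fun p _ => ?_) fun _ _ => rfl
    refine ⟨fun h => ⟨?_, h⟩, fun h => h.2⟩
    obtain ⟨b, ⟨h1, h2⟩, -⟩ := h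
    have h3 : (b.1.2 : ℕ) ≤ b.1.1 := b.2
    rw [Fin.lt_def]
    omega
  · symm
    refine Finset.sum_bij (fun p hp => (hab p (Finset.mem_filter.1 hp).2.1).choose) ?_ ?_ ?_ ?_
    · intro p hp
      have hq := (hab p (Finset.mem_filter.1 hp).2.1).choose_spec
      set q := (hab p (Finset.mem_filter.1 hp).2.1).choose
      obtain ⟨-, hp1, hp2⟩ := Finset.mem_filter.1 hp
      have hlt : ∀ r, q.Below r → y.1 r < y.1 q := by
        intro r hr
        have : r = p := GTIndex.ext_of_val (by rw [hr.1, hq.1]) (by rw [hr.2, hq.2])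
        subst this
        exact lt_of_le_of_ne ((y.2 q r).1 hr) fun h => hp2 ⟨q, hq, h⟩
      have hx : IsGTPattern (lowerArray y.1 q) := by
        refine isGTPattern_lowerArray y.2 (fun r h1 h2 => ?_) hlt
        exact ((y.2 r p).2 ⟨by rw [hq.1, h1], by rw [hq.2, h2]⟩).trans_lt (hlt p hq)
      refine Finset.mem_filter.2 ⟨Finset.mem_univ _, ⟨_, hx⟩, ?_, rfl⟩
      refine mem_patternsWithBottom.2 fun i => ?_
      show lowerArray y.1 q (bottomIndex i) = _
      rw [lowerArray_bottom, if_neg, sub_zero]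
      intro h
      have h1 := hq.1
      rw [h] at h1
      have h2 := p.1.1.2
      simp only [bottomIndex] at h1
      omega
    · intro p hp p' hp' h
      have hq := (hab p (Finset.mem_filter.1 hp).2.1).choose_spec
      have hq' := (hab p' (Finset.mem_filter.1 hp').2.1).choose_spec
      change (hab p (Finset.mem_filter.1 hp).2.1).choose =
        (hab p' (Finset.mem_filter.1 hp').2.1).choose at h
      rw [← h] at hq'
      exact GTIndex.ext_of_val (by rw [hq.1, hq'.1]) (by rw [hq.2, hq'.2])
    · intro q hq
      obtain ⟨-, x, hx, he⟩ := Finset.mem_filter.1 hq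
      rw [mem_patternsWithBottom] at hx
      have hql : (q.1.1 : ℕ) + 1 < n := by
        by_contra h
        have h0 := q.1.1.2
        have h1 : q = bottomIndex q.1.2 := GTIndex.ext_of_val (by simp only [bottomIndex]; omega) rfl
        have h2 := hx q.1.2
        rw [← he, lowerArray_bottom, if_pos h1] at h2
        omega
      have hq2 : (q.1.2 : ℕ) ≤ q.1.1 := q.2
      let p : GTIndex n := ⟨(⟨q.1.1 + 1, hql⟩, q.1.2), by
        show (q.1.2 : ℕ) ≤ q.1.1 + 1
        omega⟩
      have hqp : q.Below p := ⟨rfl, rfl⟩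
      have hlt := lt_of_isGTPattern_lowerArray (he ▸ x.2) hqp
      have hp : p ∈ Finset.univ.filter
          fun p : GTIndex n => p.1.2 < p.1.1 ∧ ¬ BlockedRight y.1 p := by
        refine Finset.mem_filter.2 ⟨Finset.mem_univ _, ?_, ?_⟩
        · rw [Fin.lt_def]
          simp only [p]
          omega
        · rintro ⟨b, hb, hyb⟩
          have : b = q := GTIndex.ext_of_val
            (by have h1 := hb.1; have h2 := hqp.1; omega)
            (by have h1 := hb.2; have h2 := hqp.2; omega)
          rw [this] at hyb
          omega
      refine ⟨p, hp, ?_⟩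
      have hb := (hab p (Finset.mem_filter.1 hp).2.1).choose_spec
      exact GTIndex.ext_of_val (by have h1 := hb.1; have h2 := hqp.1; omega)
        (by have h1 := hb.2; have h2 := hqp.2; omega)
    · intro p hp
      have hq := (hab p (Finset.mem_filter.1 hp).2.1).choose_spec
      exact (nextRate_eq v hq.1).symm

open Classical in
-- The bottom row changes only if the jump ends on the bottom level. The two rows then determine the
-- end particle, and its factor is the default value `1` of `nextRate`.
theorem sum_nextRate_of_ne {n : ℕ} (v : Fin n → ℝ) {z : Fin n → ℤ} (hz : Monotone z)
    (y : GTPattern n) (hne : y ∉ patternsWithBottom z) :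
    ∑ q : GTIndex n with ∃ x ∈ patternsWithBottom z, lowerArray y.1 q = x.1, nextRate v q =
      if ∃ i, (fun i => y.1 (bottomIndex i)) = z + Pi.single i 1 then 1 else 0 := by
  have hset : ∀ q : GTIndex n, (∃ x ∈ patternsWithBottom z, lowerArray y.1 q = x.1) ↔
      ∃ i, q = bottomIndex i ∧ (fun i => y.1 (bottomIndex i)) = z + Pi.single i 1 := by
    intro q
    constructor
    · rintro ⟨x, hx, he⟩
      rw [mem_patternsWithBottom] at hx hne
      simp only [← he, lowerArray_bottom] at hx
      push Not at hne
      obtain ⟨i, hi⟩ := hne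
      have hq : q = bottomIndex i := by
        by_contra hq
        have := hx i
        rw [if_neg hq] at this
        omega
      refine ⟨i, hq, funext fun j => ?_⟩
      have hj := hx j
      have hij : q = bottomIndex j ↔ j = i := by
        rw [hq]
        constructor
        · intro h
          exact (congrArg (fun r : GTIndex n => r.1.2) h).symm
        · rintro rfl; rfl
      simp only [hij] at hj
      rw [Pi.add_apply, Pi.single_apply]
      omega
    · rintro ⟨i, rfl, h⟩
      have hy : ∀ j, y.1 (bottomIndex j) = z j + if j = i then 1 else 0 := fun j => by
        have := congrFun h j
        rwa [Pi.add_apply, Pi.single_apply] at this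
      have hx : IsGTPattern (lowerArray y.1 (bottomIndex i)) := by
        -- Nothing lies below the bottom row, so the only real condition is strictness against the
        -- left neighbour, which follows from monotonicity of `z`.
        refine isGTPattern_lowerArray y.2 (fun r h1 h2 => ?_) (fun r hr => ?_)
        · have hr : r = bottomIndex r.1.2 := GTIndex.ext_of_val h1 rfl
          have h3 : (r.1.2 : ℕ) + 1 = i := h2
          rw [hr, hy, hy, if_pos rfl, if_neg]
          · have : z r.1.2 ≤ z i := hz (by rw [Fin.le_def]; omega)
            omega
          · intro h4
            rw [h4] at h3
            omega
        · have h1 := hr.1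
          have h2 := r.1.1.2
          simp only [bottomIndex] at h1
          omega
      refine ⟨⟨_, hx⟩, mem_patternsWithBottom.2 fun j => ?_, rfl⟩
      show lowerArray y.1 (bottomIndex i) (bottomIndex j) = z j
      rw [lowerArray_bottom, hy]
      have hij : bottomIndex i = bottomIndex j ↔ j = i := by
        constructor
        · intro h
          exact (congrArg (fun r : GTIndex n => r.1.2) h).symm
        · rintro rfl; rfl
      simp only [hij]
      omega
  simp only [hset]
  split_ifs with h
  · obtain ⟨i, hi⟩ := h
    rw [Finset.sum_eq_single (bottomIndex i)]
    · refine nextRate_eq_one v ?_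
      have := i.2
      simp only [bottomIndex]
      omega
    · intro q hq hqi
      obtain ⟨-, j, rfl, hj⟩ := Finset.mem_filter.1 hq
      exfalso
      refine hqi ?_
      rw [hi] at hj
      have h1 := congrFun (add_left_cancel hj) i
      rw [Pi.single_eq_same, Pi.single_apply] at h1
      split_ifs at h1 with h2
      · rw [h2]
      · omega
    · intro h'
      exact absurd (Finset.mem_filter.2 ⟨Finset.mem_univ _, i, rfl, hi⟩) h'
  · refine Finset.sum_eq_zero fun q hq => ?_
    obtain ⟨-, j, -, hj⟩ := Finset.mem_filter.1 hq
    exact absurd ⟨j, hj⟩ h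

open Classical in
theorem sum_weight_ringRight {n : ℕ} {v : Fin n → ℝ} (hv : ∀ i, 0 < v i) {z : Fin n → ℤ}
    (hz : Monotone z) (y : GTPattern n) :
    ∑ x ∈ patternsWithBottom z, weight v x *
        ∑ p : GTIndex n, v p.1.1 * (if y = x.ringRight p then 1 else 0) =
      weight v y * (if y ∈ patternsWithBottom z then ∑ p : GTIndex n with p.1.2 < p.1.1, v p.1.1
        else if ∃ i, (fun i => y.1 (bottomIndex i)) = z + Pi.single i 1 then 1 else 0) := by
  rw [sum_ringRight_eq hv]
  congr 1
  split_ifs with h1 h2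
  · have : z = fun i => y.1 (bottomIndex i) := funext fun i => (mem_patternsWithBottom.1 h1 i).symm
    rw [this]
    exact sum_blocked_add_sum_nextRate v y
  · rw [sum_nextRate_of_ne v hz y h1, if_pos h2, zero_add]
  · rw [sum_nextRate_of_ne v hz y h1, if_neg h2, zero_add]

/-! ### Reflection -/

/-- The reflection of labels that exchanges `x^j_i` and `x^j_{j+1-i}`. -/
def GTIndex.reflect {n : ℕ} (p : GTIndex n) : GTIndex n :=
  ⟨(p.1.1, ⟨p.1.1 - p.1.2, lt_of_le_of_lt (Nat.sub_le _ _) p.1.1.2⟩), Nat.sub_le _ _⟩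

theorem GTIndex.reflect_level {n : ℕ} (p : GTIndex n) : p.reflect.1.1 = p.1.1 := rfl

theorem GTIndex.reflect_pos {n : ℕ} (p : GTIndex n) :
    (p.reflect.1.2 : ℕ) = p.1.1 - p.1.2 := rfl

theorem GTIndex.reflect_reflect {n : ℕ} (p : GTIndex n) : p.reflect.reflect = p := by
  have h : (p.1.2 : ℕ) ≤ p.1.1 := p.2
  refine GTIndex.ext_of_val rfl ?_
  rw [reflect_pos, reflect_pos, reflect_level]
  omega

theorem GTIndex.below_reflect {n : ℕ} {p q : GTIndex n} :
    p.reflect.Below q.reflect ↔ p.BelowNext q := by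
  have h1 : (p.1.2 : ℕ) ≤ p.1.1 := p.2
  have h2 : (q.1.2 : ℕ) ≤ q.1.1 := q.2
  unfold Below BelowNext
  rw [reflect_pos, reflect_pos, reflect_level, reflect_level]
  omega

theorem GTIndex.belowNext_reflect {n : ℕ} {p q : GTIndex n} :
    p.reflect.BelowNext q.reflect ↔ p.Below q := by
  rw [← below_reflect, reflect_reflect, reflect_reflect]

theorem bottomIndex_reflect {n : ℕ} (i : Fin n) : (bottomIndex i).reflect = bottomIndex i.rev := by
  refine GTIndex.ext_of_val rfl ?_
  rw [GTIndex.reflect_pos]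
  simp only [bottomIndex, Fin.val_rev]
  omega

/-- The reflection of arrays. -/
def reflectArray {n : ℕ} (x : GTIndex n → ℤ) : GTIndex n → ℤ := fun p => -x p.reflect

theorem reflectArray_reflectArray {n : ℕ} (x : GTIndex n → ℤ) :
    reflectArray (reflectArray x) = x := by
  funext p
  simp [reflectArray, GTIndex.reflect_reflect]

theorem isGTPattern_reflectArray {n : ℕ} {x : GTIndex n → ℤ} (hx : IsGTPattern x) :
    IsGTPattern (reflectArray x) := fun _ _ =>
  ⟨fun h => neg_le_neg ((hx _ _).2 (GTIndex.belowNext_reflect.2 h)),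
    fun h => neg_le_neg ((hx _ _).1 (GTIndex.below_reflect.2 h))⟩

theorem blockedRight_reflectArray {n : ℕ} {x : GTIndex n → ℤ} {p : GTIndex n} :
    BlockedRight (reflectArray x) p.reflect ↔ BlockedLeft x p := by
  constructor
  · rintro ⟨b, hb, h⟩
    refine ⟨b.reflect, GTIndex.below_reflect.1 (by rwa [GTIndex.reflect_reflect]), ?_⟩
    simpa [reflectArray, GTIndex.reflect_reflect] using h
  · rintro ⟨b, hb, h⟩
    refine ⟨b.reflect, GTIndex.below_reflect.2 hb, ?_⟩
    simpa [reflectArray, GTIndex.reflect_reflect] using h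

theorem movesRight_reflectArray {n : ℕ} {x : GTIndex n → ℤ} {p q : GTIndex n} :
    MovesRight (reflectArray x) p.reflect q.reflect ↔ MovesLeft x p q := by
  constructor
  · have : ∀ r, MovesRight (reflectArray x) p.reflect r → MovesLeft x p r.reflect := by
      intro r h
      induction h with
      | self => rw [GTIndex.reflect_reflect]; exact .self
      | push q r _ hqr he ih =>
        refine .push _ _ ih (GTIndex.belowNext_reflect.1 ?_) (neg_injective he)
        rwa [GTIndex.reflect_reflect, GTIndex.reflect_reflect]
    intro h
    simpa [GTIndex.reflect_reflect] using this _ h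
  · intro h
    induction h with
    | self => exact .self
    | push q r _ hqr he ih =>
      refine .push _ _ ih (GTIndex.belowNext_reflect.2 hqr) ?_
      simp [reflectArray, GTIndex.reflect_reflect, he]

theorem rightArray_reflectArray {n : ℕ} (x : GTIndex n → ℤ) (p : GTIndex n) :
    rightArray (reflectArray x) p.reflect = reflectArray (leftArray x p) := by
  unfold rightArray leftArray
  rw [blockedRight_reflectArray]
  split_ifs with h
  · rfl
  · funext q
    obtain ⟨r, rfl⟩ : ∃ r : GTIndex n, q = r.reflect := ⟨q.reflect, q.reflect_reflect.symm⟩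
    have e : ∀ a, reflectArray a r.reflect = -a r := fun a => by
      rw [reflectArray, GTIndex.reflect_reflect]
    rw [e]
    by_cases hm : MovesLeft x p r
    · rw [if_pos (movesRight_reflectArray.2 hm), e, if_pos hm]
      ring
    · rw [if_neg fun h' => hm (movesRight_reflectArray.1 h'), e, if_neg hm]

/-- The reflection of patterns. -/
def GTPattern.reflect {n : ℕ} (x : GTPattern n) : GTPattern n :=
  ⟨reflectArray x.1, isGTPattern_reflectArray x.2⟩

theorem GTPattern.reflect_reflect {n : ℕ} (x : GTPattern n) : x.reflect.reflect = x :=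
  Subtype.ext (reflectArray_reflectArray x.1)

theorem GTPattern.reflect_injective {n : ℕ} : Function.Injective (GTPattern.reflect (n := n)) :=
  Function.LeftInverse.injective GTPattern.reflect_reflect

theorem GTPattern.ringRight_reflect {n : ℕ} (x : GTPattern n) (p : GTIndex n) :
    x.reflect.ringRight p.reflect = (x.ringLeft p).reflect :=
  Subtype.ext (rightArray_reflectArray x.1 p)

theorem GTPattern.reflect_bottom {n : ℕ} (x : GTPattern n) (i : Fin n) :
    x.reflect.1 (bottomIndex i) = -x.1 (bottomIndex i.rev) := by
  show -x.1 (bottomIndex i).reflect = _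
  rw [bottomIndex_reflect]

theorem levelSum_reflectArray {n : ℕ} (x : GTIndex n → ℤ) (k : ℕ) :
    levelSum (reflectArray x) k = -levelSum x k := by
  unfold levelSum reflectArray
  rw [Finset.sum_neg_distrib]
  congr 1
  refine Finset.sum_nbij' GTIndex.reflect GTIndex.reflect ?_ ?_ ?_ ?_ ?_
  · intro p hp; simpa [GTIndex.reflect_level] using hp
  · intro p hp; simpa [GTIndex.reflect_level] using hp
  · intro p _; exact p.reflect_reflect
  · intro p _; exact p.reflect_reflect
  · intro p _; rfl

theorem weight_reflect {n : ℕ} (v : Fin n → ℝ) (x : GTPattern n) :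
    weight (fun i => (v i)⁻¹) x.reflect = weight v x := by
  unfold weight
  refine Finset.prod_congr rfl fun i _ => ?_
  show (v i)⁻¹ ^ (levelSum (reflectArray x.1) (i + 1) - levelSum (reflectArray x.1) i) = _
  rw [levelSum_reflectArray, levelSum_reflectArray, inv_zpow', neg_sub_neg, neg_sub]

theorem reflect_mem_patternsWithBottom {n : ℕ} {z : Fin n → ℤ} {x : GTPattern n} :
    x.reflect ∈ patternsWithBottom (fun i => -z i.rev) ↔ x ∈ patternsWithBottom z := by
  rw [mem_patternsWithBottom, mem_patternsWithBottom]
  simp only [GTPattern.reflect_bottom, neg_inj]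
  exact ⟨fun h i => by simpa using h i.rev, fun h i => h i.rev⟩

open Classical in
-- Negating positions and reversing each level exchanges left and right jumps. Inverting `v` at the
-- same time preserves weights and matches the clock rates.
theorem sum_weight_ringLeft {n : ℕ} {v : Fin n → ℝ} (hv : ∀ i, 0 < v i) {z : Fin n → ℤ}
    (hz : Monotone z) (y : GTPattern n) :
    ∑ x ∈ patternsWithBottom z, weight v x *
        ∑ p : GTIndex n, (v p.1.1)⁻¹ * (if y = x.ringLeft p then 1 else 0) =
      weight v y * (if y ∈ patternsWithBottom z then
        ∑ p : GTIndex n with p.1.2 < p.1.1, (v p.1.1)⁻¹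
        else if ∃ i, (fun i => y.1 (bottomIndex i)) = z - Pi.single i 1 then 1 else 0) := by
  have h := sum_weight_ringRight (v := fun i => (v i)⁻¹) (fun i => inv_pos.2 (hv i))
    (z := fun i => -z i.rev) (fun i j hij => neg_le_neg (hz (Fin.rev_le_rev.2 hij))) y.reflect
  rw [weight_reflect] at h
  simp only [reflect_mem_patternsWithBottom] at h
  have e : (∃ i, (fun i => y.reflect.1 (bottomIndex i)) =
      (fun i => -z i.rev) + (Pi.single i 1 : Fin n → ℤ)) ↔
      ∃ i, (fun i => y.1 (bottomIndex i)) = z - (Pi.single i 1 : Fin n → ℤ) := by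
    rw [← Fin.revPerm.exists_congr_right]
    refine exists_congr fun i => ?_
    simp only [funext_iff, GTPattern.reflect_bottom, Pi.add_apply, Pi.sub_apply, Pi.single_apply,
      Fin.revPerm_apply]
    rw [← Fin.revPerm.forall_congr_right]
    refine forall_congr' fun j => ?_
    simp only [Fin.revPerm_apply, Fin.rev_rev, Fin.rev_inj]
    omega
  simp only [e] at h
  rw [← h]
  refine Finset.sum_nbij' GTPattern.reflect GTPattern.reflect ?_ ?_ ?_ ?_ ?_
  · intro x hx; exact reflect_mem_patternsWithBottom.2 hx
  · intro x hx
    rw [← x.reflect_reflect] at hx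
    exact reflect_mem_patternsWithBottom.1 hx
  · intro x _; exact x.reflect_reflect
  · intro x _; exact x.reflect_reflect
  · intro x _
    rw [weight_reflect]
    congr 1
    refine Finset.sum_nbij' GTIndex.reflect GTIndex.reflect ?_ ?_ ?_ ?_ ?_
    · simp
    · simp
    · intro p _; exact p.reflect_reflect
    · intro p _; exact p.reflect_reflect
    · intro p _
      simp only [GTPattern.ringRight_reflect, GTPattern.reflect_injective.eq_iff]
      rfl

/-! ### The intertwining -/

open Classical in
theorem isConservativeQMatrix_pushBlockQ {n : ℕ} {v : Fin n → ℝ} (hv : ∀ i, 0 < v i) :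
    IsConservativeQMatrix (pushBlockQ v) := by
  refine ⟨fun x y hxy => Finset.sum_nonneg fun p _ => ?_, fun x => ?_⟩
  · rw [if_neg hxy.symm, sub_zero, sub_zero]
    have := hv p.1.1
    positivity
  · have h1 : ∀ a : GTPattern n, HasSum (fun y => if y = a then (1 : ℝ) else 0) 1 := fun a =>
      hasSum_ite_eq a 1
    have h2 : HasSum (pushBlockQ v x)
        (∑ p : GTIndex n, (v p.1.1 * (1 - 1) + (v p.1.1)⁻¹ * (1 - 1))) :=
      hasSum_sum fun p _ => (((h1 _).sub (h1 _)).mul_left _).add (((h1 _).sub (h1 _)).mul_left _)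
    simpa using h2

theorem finite_rows_pushBlockQ {n : ℕ} (v : Fin n → ℝ) (x : GTPattern n) :
    {y | pushBlockQ v x y ≠ 0}.Finite := by
  refine ((Set.finite_range fun p => x.ringRight p).union
    ((Set.finite_range fun p => x.ringLeft p).union (Set.finite_singleton x))).subset fun y hy => ?_
  by_contra h
  simp only [Set.mem_union, Set.mem_range, Set.mem_singleton_iff, not_or, not_exists] at h
  obtain ⟨h1, h2, h3⟩ := h
  refine hy (Finset.sum_eq_zero fun p _ => ?_)
  rw [if_neg fun e => h1 p e.symm, if_neg h3, if_neg fun e => h2 p e.symm]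
  simp

theorem sum_GTIndex_eq {n : ℕ} (c : Fin n → ℝ) :
    ∑ p : GTIndex n, c p.1.1 = ∑ p : GTIndex n with p.1.2 < p.1.1, c p.1.1 + ∑ i, c i := by
  rw [← Finset.sum_filter_add_sum_filter_not Finset.univ (fun p : GTIndex n => p.1.2 < p.1.1)]
  congr 1
  refine Finset.sum_nbij' (fun p => p.1.1) (fun i => ⟨(i, i), le_rfl⟩) ?_ ?_ ?_ ?_ ?_
  · simp
  · simp
  · intro p hp
    simp only [Finset.mem_filter, Finset.mem_univ, true_and, not_lt] at hp
    exact Subtype.ext (Prod.ext rfl (le_antisymm hp p.2))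
  · simp
  · simp

open Classical in
-- On the fibre over `z`, the inflow is the total rate of the particles with `i < j`, and the
-- outflow is the rate of all particles. The difference is carried by the particles with `i = j`,
-- one per level.
theorem sum_weight_mul_pushBlockQ {n : ℕ} {v : Fin n → ℝ} (hv : ∀ i, 0 < v i) (z : WeylChamber n)
    (y : GTPattern n) :
    ∑ x ∈ patternsWithBottom z.1, weight v x * pushBlockQ v x y =
      weight v y * (if y.bottom = z then - ∑ i, ((v i)⁻¹ + v i)
        else if ∃ i, y.bottom.1 = z.1 + Pi.single i 1 ∨ y.bottom.1 = z.1 - Pi.single i 1 then 1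
        else 0) := by
  have h1 : ∀ x, weight v x * pushBlockQ v x y =
      weight v x * ∑ p : GTIndex n, v p.1.1 * (if y = x.ringRight p then 1 else 0) +
      weight v x * ∑ p : GTIndex n, (v p.1.1)⁻¹ * (if y = x.ringLeft p then 1 else 0) -
      if y = x then weight v x * (∑ p : GTIndex n, v p.1.1 + ∑ p : GTIndex n, (v p.1.1)⁻¹)
        else 0 := by
    intro x
    have h2 : (if y = x then
        weight v x * (∑ p : GTIndex n, v p.1.1 + ∑ p : GTIndex n, (v p.1.1)⁻¹) else 0) =
        weight v x * (∑ p : GTIndex n, v p.1.1 * (if y = x then 1 else 0) +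
          ∑ p : GTIndex n, (v p.1.1)⁻¹ * (if y = x then 1 else 0)) := by
      split_ifs <;> simp
    rw [h2, ← mul_add, ← mul_sub, ← Finset.sum_add_distrib, ← Finset.sum_add_distrib,
      ← Finset.sum_sub_distrib, pushBlockQ]
    congr 1
    refine Finset.sum_congr rfl fun p _ => ?_
    ring
  simp only [h1]
  rw [Finset.sum_sub_distrib, Finset.sum_add_distrib, sum_weight_ringRight hv z.2,
    sum_weight_ringLeft hv z.2, Finset.sum_ite_eq]
  simp only [mem_patternsWithBottom_iff_bottom]
  rw [sum_GTIndex_eq v, sum_GTIndex_eq fun i => (v i)⁻¹, Finset.sum_add_distrib]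
  have hb : (fun i => y.1 (bottomIndex i)) = y.bottom.1 := rfl
  rw [hb]
  by_cases hz : y.bottom = z
  · simp only [if_pos hz]
    ring
  · simp only [if_neg hz]
    by_cases hp : ∃ i, y.bottom.1 = z.1 + Pi.single i 1
    · have hm : ¬ ∃ i, y.bottom.1 = z.1 - Pi.single i 1 := by
        rintro ⟨j, hj⟩
        obtain ⟨i, hi⟩ := hp
        rw [hi] at hj
        have := congrFun hj i
        simp only [Pi.add_apply, Pi.sub_apply, Pi.single_eq_same, Pi.single_apply] at this
        split_ifs at this <;> omega
      rw [if_pos hp, if_neg hm, if_pos (hp.imp fun i hi => Or.inl hi)]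
      ring
    · by_cases hm : ∃ i, y.bottom.1 = z.1 - Pi.single i 1
      · rw [if_neg hp, if_pos hm, if_pos (hm.imp fun i hi => Or.inr hi)]
        ring
      · rw [if_neg hp, if_neg hm, if_neg]
        · ring
        · rintro ⟨i, hi | hi⟩
          · exact hp ⟨i, hi⟩
          · exact hm ⟨i, hi⟩

theorem intertwining_pushBlockQ {n : ℕ} {v : Fin n → ℝ} (hv : ∀ i, 0 < v i) :
    Intertwining (GTPattern.bottom (n := n)) (fun z => patternsWithBottom z.1)
      (fun x => weight v x / schur x.bottom.1 v) (pushBlockQ v) (schurQ v) where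
  mem_fib := mem_patternsWithBottom_iff_bottom
  nonneg x := div_nonneg (weight_pos hv x).le (schur_pos _ v hv).le
  sum_one z := by
    rw [Finset.sum_congr rfl fun x hx => by
      rw [(mem_patternsWithBottom_iff_bottom z x).1 hx], ← Finset.sum_div,
      ← schur_eq_sum_weight z v hv, div_self (schur_pos z v hv).ne']
  conservative := isConservativeQMatrix_pushBlockQ hv
  finite_rows := finite_rows_pushBlockQ v
  -- The diagonal of `schurQ v` is constant; this is what makes uniqueness for the backward equation
  -- available.
  bounded := ⟨∑ i, ((v i)⁻¹ + v i), fun z => by simp [schurQ]⟩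
  intertwine z y := by
    have h1 : ∀ x ∈ patternsWithBottom z.1, weight v x / schur x.bottom.1 v * pushBlockQ v x y =
        (schur z.1 v)⁻¹ * (weight v x * pushBlockQ v x y) := fun x hx => by
      rw [(mem_patternsWithBottom_iff_bottom z x).1 hx]
      ring
    rw [Finset.sum_congr rfl h1, ← Finset.mul_sum, sum_weight_mul_pushBlockQ hv]
    have h2 := (schur_pos z v hv).ne'
    have h3 := (schur_pos y.bottom v hv).ne'
    unfold schurQ
    split_ifs with h4 h5
    · rw [h4]
      field_simp
    · field_simp
    · simp

theorem mainTheorem8 (n : ℕ) (hn : 1 ≤ n) (v : Fin n → ℝ) (hv : ∀ i, 0 < v i)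
    (z : WeylChamber n)
    {Ω : Type*} [MeasurableSpace Ω] (μ : Measure Ω) [IsProbabilityMeasure μ]
    (X : ℝ≥0 → Ω → GTPattern n)
    (hX : IsMarkovProcess μ X (pushBlockQ v))
    (hX0 : ∀ x : GTPattern n, μ.real {ω | X 0 ω = x} = gibbs v z x) :
    IsConservativeQMatrix (schurQ v) ∧
      IsMarkovProcess μ (fun t ω => (X t ω).bottom) (schurQ v) := by
  have I := intertwining_pushBlockQ hv
  refine ⟨I.isConservativeQMatrix, I.isMarkov_comp μ X hX z fun x hx => ?_⟩
  have hb := (mem_patternsWithBottom_iff_bottom z x).1 hx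
  rw [hX0, gibbs, if_pos hb, hb]
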